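/- **Setting.** Let $\mathcal S$ be a set of $N$ positions. The environment state $\phi_k\in\mathbb R^N$ obeys $\phi_{k+1}=A_{k+1}\phi_k$, where for constants $0<\underline\alpha\le\bar\alpha$ and all $k\ge t>0$, $\underline\alpha I_N\preceq A[k:t]^\top A[k:t]\preceq\bar\alpha I_N$ with $A[k:t]=A_kA_{k-1}\cdots A_t$. Only the state with a type I (external) disturbance is measurable: $\tilde\phi_0=\phi_0$, $\tilde\phi_{k+1}=A_{k+1}\phi_k+\delta_k$, where $(\delta_k)$ is a deterministic sequence and $(B_K)_{K\ge 0}$ is a positive nondecreasing sequence with $\sum_{k=0}^K\|\delta_k\|\le B_K$ for all $K\ge0$. There are $I$ agents; agent $i$ located at $s\in\mathcal S$ senses a set of $m$ positions that contains $s$, and $H_k$ is the matrix whose rows are the unit vectors of the positions sensed by the agents at their positions $p_k=(p_k[1],\dots,p_k[I])\in\mathcal S^I$. The stacked measurement is $z_k=H_k\tilde\phi_k+n_k$ with $n_k$ i.i.d. Gaussian of mean $0$ and covariance $V=\mathrm{Diag}\{v^1I_m,\dots,v^II_m\}$, $0<\underline v\le v^i\le\bar v$. Put $Y_k=H_k^\top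 V^{-1}H_k$ and $y_k=H_k^\top V^{-1}z_k$. **Algorithm.** Given $\hat\phi_0\in\mathbb R^N$ and $\Sigma_0$ with $\underline\sigma I_N\preceq\Sigma_0\preceq\bar\sigma I_N$ ($0<\underline\sigma\le\bar\sigma$), and $\Gamma_0=I_N$, $\omega_{-1}=0$, the discounted Kalman filter is $$\Sigma_{k+1/2}=(\Sigma_k^{-1}+\lambda_kY_k)^{-1},\quad \hat\phi_{k+1/2}=\hat\phi_k+\lambda_k\Sigma_{k+1/2}(y_k-Y_k\hat\phi_k),$$ $$\Sigma_{k+1}=A_{k+1}\big(\Sigma_{k+1/2}^{-1}+(\omega_k-\omega_{k-1})\Gamma_k^{-1}\big)^{-1}A_{k+1}^\top,\quad \hat\phi_{k+1}=\Sigma_{k+1}A_{k+1}^{-\top}\Sigma_{k+1/2}^{-1}\hat\phi_{k+1/2},\quad \Gamma_{k+1}=A_{k+1}\Gamma_kA_{k+1}^\top,$$ with $\omega_k\equiv0$ and $\lambda_k=\min\{1,\bar\lambda/\|Y_k\|_{\Sigma_k}\}$, where $\|Y\|_\Sigma^2$ is the largest eigenvalue of $Y^\top\Sigma Y$. The D-UCB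 is $\mu_k=\hat\phi_k+\beta_k\,\mathrm{diag}^{1/2}(\Sigma_k)$. The initial positions $p_0$ are arbitrary, and for every $k\ge0$, $p_{k+1}$ maximizes $\sum_{s\in\bigcup_i\{p[i]\}}\mu_{k+1}(s)$ over $p\in\mathcal S^I$; each $p_k$ (including the choice among several maximizers) depends only on information that is independent of the noises $n_k,n_{k+1},\dots$. **Parameters.** Let $0<\delta<1$, $C_1=\|\hat\phi_0-\phi_0\|/\sqrt{\underline\sigma}$, $C_2=\max\{1,\ \bar v^2\sqrt{\max\{2,2/\underline v\}}\}$ and $$L_k=\sqrt N\Big(\bar\lambda B_k+C_1+C_2\sqrt N\sqrt{\log\Big(\frac{\bar\sigma/\underline\sigma+\bar\alpha\bar\sigma k/\underline v^2}{\delta^{2/N}}\Big)}\Big).$$ Let the confidence sequence satisfy $L_k\le\beta_k\le\kappa L_k$ for all $k\ge0$, with a constant $\kappa$. **Theorem.** Let $F_k(p)=\sum_{s\in\bigcup_i\{p[i]\}}\phi_k(s)$ and $R_K=\sum_{k=0}^K\big(\max_{p\in\mathcal S^I}F_k(p)-F_k(p_k)\big)$; the regret is measured against the undisturbed state $\phi_k$.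 For every $K>0$, if the algorithm is run with $\bar\lambda=\sqrt N/B_K$, then with probability at least $1-\delta$ $$R_K\le\widetilde{\mathcal O}\big(N^2\sqrt K+N^{5/2}B_K\big),$$ that is, $R_K\le C\,(N^2\sqrt K+N^{5/2}B_K)(1+\log K)^q$ with an absolute constant $q$ and a constant $C$ that depends only on $I,\underline\alpha,\bar\alpha,\underline\sigma,\bar\sigma,\underline v,\bar v,\delta,\kappa$ and on a common upper bound of $\|\phi_0\|$ and $\|\hat\phi_0-\phi_0\|$. -/

import Mathlib

open MeasureTheory ProbabilityTheory
open scoped Matrix NNReal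

noncomputable section

namespace SourceSeeking

/-- The Euclidean norm of a vector of `ℝ^N`. -/
def l2norm {N : ℕ} (x : Fin N → ℝ) : ℝ := ‖WithLp.toLp 2 x‖

/-- `lo • 1 ⪯ X ⪯ hi • 1` in the Loewner order. -/
def LoewnerBetween {N : ℕ} (lo hi : ℝ) (X : Matrix (Fin N) (Fin N) ℝ) : Prop :=
  (X - lo • (1 : Matrix (Fin N) (Fin N) ℝ)).PosSemidef ∧
    (hi • (1 : Matrix (Fin N) (Fin N) ℝ) - X).PosSemidef

/-- The state propagation matrix `A[k:t] = A_k A_{k-1} ⋯ A_t`, with `A[k:t] = 1` for `k < t`.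
The arguments come in the order `A`, `t`, `k`. -/
def propagation {N : ℕ} (A : ℕ → Matrix (Fin N) (Fin N) ℝ) (t : ℕ) :
    ℕ → Matrix (Fin N) (Fin N) ℝ
  | 0 => if 0 < t then 1 else A 0
  | k + 1 => if k + 1 < t then 1 else A (k + 1) * propagation A t k

/-- The data of a source seeking problem with `I` agents on the `N` positions `Fin N`, in which
every agent senses `m` positions. -/
structure Model (I N m : ℕ) where
  /-- transition matrices; `A (k + 1)` leads from time `k` to time `k + 1` -/
  A : ℕ → Matrix (Fin N) (Fin N) ℝ
  /-- state of the environment at time `0` -/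
  phi0 : Fin N → ℝ
  /-- the non-stochastic disturbances -/
  dist : ℕ → Fin N → ℝ
  /-- `sense i s` lists the `m` positions sensed by agent `i` when it is located at `s` -/
  sense : Fin I → Fin N → Fin m → Fin N
  /-- the noise variance of each agent -/
  v : Fin I → ℝ≥0

namespace Model

variable {I N m : ℕ} (M : Model I N m)

/-- The undisturbed state `φ_k`. -/
def state : ℕ → Fin N → ℝ
  | 0 => M.phi0
  | k + 1 => M.A (k + 1) *ᵥ state k

/-- The state with the external disturbance (type I), which does not enter the dynamics. -/
def disturbedState : ℕ → Fin N → ℝ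
  | 0 => M.phi0
  | k + 1 => M.A (k + 1) *ᵥ M.state k + M.dist k

/-- The stacked measurement matrix when the agents are located at `pos`: the row `(i, j)` is the
unit row vector of the `j`-th position sensed by agent `i`. -/
def measMatrix (pos : Fin I → Fin N) : Matrix (Fin I × Fin m) (Fin N) ℝ :=
  Matrix.of fun r l => if M.sense r.1 (pos r.1) r.2 = l then 1 else 0

/-- The covariance matrix `V` of the stacked noise. -/
def noiseCov : Matrix (Fin I × Fin m) (Fin I × Fin m) ℝ :=
  Matrix.diagonal fun r => (M.v r.1 : ℝ)

/-- The law of the stacked noise: independent centred Gaussian entries, of variance `v i` for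
agent `i`. -/
def noiseLaw : Measure (Fin I × Fin m → ℝ) :=
  Measure.pi fun r => gaussianReal 0 (M.v r.1)

/-- The stacked measurement `z_k = H_k φ̃_k + n_k`. -/
def measurement (k : ℕ) (pos : Fin I → Fin N) (noise : Fin I × Fin m → ℝ) :
    Fin I × Fin m → ℝ :=
  M.measMatrix pos *ᵥ M.disturbedState k + noise

/-- `Y_k = H_kᵀ V⁻¹ H_k`. -/
def infoMatrix (pos : Fin I → Fin N) : Matrix (Fin N) (Fin N) ℝ :=
  (M.measMatrix pos)ᵀ * (M.noiseCov)⁻¹ * M.measMatrix pos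

/-- `y_k = H_kᵀ V⁻¹ z_k`. -/
def infoVector (k : ℕ) (pos : Fin I → Fin N) (noise : Fin I × Fin m → ℝ) : Fin N → ℝ :=
  ((M.measMatrix pos)ᵀ * (M.noiseCov)⁻¹) *ᵥ M.measurement k pos noise

end Model

/-- The matrix norm `‖Y‖_Σ = sup_{‖x‖ ≤ 1} ‖Y x‖_Σ`, where `‖u‖_Σ = √(uᵀ Σ u)` and `Σ` is positive
semidefinite: the square root of the largest eigenvalue, i.e. of the `ℓ²` operator norm,
of `Yᵀ Σ Y`. -/
def weightedNorm {N : ℕ} (S Y : Matrix (Fin N) (Fin N) ℝ) : ℝ :=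
  Real.sqrt ‖Matrix.toEuclideanCLM (n := Fin N) (𝕜 := ℝ) (Yᵀ * S * Y)‖

/-- The weight `min {1, λ̄ / ‖Y‖_Σ}`. -/
def adaptiveWeight {N : ℕ} (lamBar : ℝ) (S Y : Matrix (Fin N) (Fin N) ℝ) : ℝ :=
  min 1 (lamBar / weightedNorm S Y)

/-- The state of the discounted Kalman filter: the mean `φ̂_k`, the covariance `Σ_k` and the
auxiliary matrix `Γ_k`. -/
structure FilterState (N : ℕ) where
  mean : Fin N → ℝ
  cov : Matrix (Fin N) (Fin N) ℝ
  aux : Matrix (Fin N) (Fin N) ℝ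

/-- One recursion of the discounted Kalman filter, with `A = A_{k+1}`, `Y = Y_k`, `y = y_k`,
`lam = λ_k` and `dom = ω_k - ω_{k-1}`. -/
def kalmanStep {N : ℕ} (A Y : Matrix (Fin N) (Fin N) ℝ) (y : Fin N → ℝ) (lam dom : ℝ)
    (x : FilterState N) : FilterState N :=
  let covHalf : Matrix (Fin N) (Fin N) ℝ := (x.cov⁻¹ + lam • Y)⁻¹
  let meanHalf : Fin N → ℝ := x.mean + lam • (covHalf *ᵥ (y - Y *ᵥ x.mean))
  let covNext : Matrix (Fin N) (Fin N) ℝ := A * (covHalf⁻¹ + dom • x.aux⁻¹)⁻¹ * Aᵀ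
  { mean := (covNext * (Aᵀ)⁻¹ * covHalf⁻¹) *ᵥ meanHalf
    cov := covNext
    aux := A * x.aux * Aᵀ }

/-- `ω_{k-1}`, with `ω_{-1} = 0`. -/
def prevWeight (om : ℕ → ℝ) : ℕ → ℝ
  | 0 => 0
  | k + 1 => om k

/-- The discounted Kalman filter with weights `λ_k = min {1, λ̄ / ‖Y_k‖_{Σ_k}}` and `ω_k`, started
at the mean `mean0` and the covariance `cov0` (and `Γ_0 = 1`), along given positions of the agents
and given noises. -/
def kalmanFilter {I N m : ℕ} (M : Model I N m) (mean0 : Fin N → ℝ)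
    (cov0 : Matrix (Fin N) (Fin N) ℝ) (lamBar : ℝ) (om : ℕ → ℝ)
    (pos : ℕ → Fin I → Fin N) (noise : ℕ → Fin I × Fin m → ℝ) : ℕ → FilterState N
  | 0 => ⟨mean0, cov0, 1⟩
  | k + 1 =>
    let x := kalmanFilter M mean0 cov0 lamBar om pos noise k
    kalmanStep (M.A (k + 1)) (M.infoMatrix (pos k)) (M.infoVector k (pos k) (noise k))
      (adaptiveWeight lamBar x.cov (M.infoMatrix (pos k))) (om k - prevWeight om k) x

/-- The D-UCB `μ = φ̂ + β diag^{1/2}(Σ)`. -/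
def ducb {N : ℕ} (x : FilterState N) (beta : ℝ) : Fin N → ℝ :=
  fun s => x.mean s + beta * Real.sqrt (x.cov s s)

/-- The total value `∑_{s ∈ ⋃ p[i]} f(s)` of the set of positions occupied by the agents. -/
def objective {I N : ℕ} (f : Fin N → ℝ) (pos : Fin I → Fin N) : ℝ :=
  ∑ s ∈ Finset.univ.image pos, f s

/-- The regret of `pos` against the best choice of positions for `f`. -/
def regret {I N : ℕ} (f : Fin N → ℝ) (pos : Fin I → Fin N) : ℝ :=
  (⨆ q : Fin I → Fin N, objective f q) - objective f pos

/-- The cumulative regret `∑_{k=0}^K r_k`, measured against the undisturbed state. -/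
def cumRegret {I N m : ℕ} (M : Model I N m) (pos : ℕ → Fin I → Fin N) (K : ℕ) : ℝ :=
  ∑ k ∈ Finset.range (K + 1), regret (M.state k) (pos k)

/-- The constants of the problem: bounds on the propagation matrices, on the initial covariance
and on the noise variances, and the confidence parameter `δ`. -/
structure Bounds where
  alphaLo : ℝ
  alphaHi : ℝ
  sigmaLo : ℝ
  sigmaHi : ℝ
  vLo : ℝ
  vHi : ℝ
  delta : ℝ

/-- Admissible values of the constants. -/
structure Bounds.Valid (b : Bounds) : Prop where
  alpha_pos : 0 < b.alphaLo
  alpha_le : b.alphaLo ≤ b.alphaHi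
  sigma_pos : 0 < b.sigmaLo
  sigma_le : b.sigmaLo ≤ b.sigmaHi
  v_pos : 0 < b.vLo
  v_le : b.vLo ≤ b.vHi
  delta_pos : 0 < b.delta
  delta_lt : b.delta < 1

/-- The constant `C₂ = max {1, v̄² √(max {2, 2 / v̲})}`. -/
def Bounds.C2 (b : Bounds) : ℝ :=
  max 1 (b.vHi ^ 2 * Real.sqrt (max 2 (2 / b.vLo)))

/-- The lower bound required of `β_k(δ)`:
`√N (λ̄ B_k + C₁ + C₂ √N √(log ((σ̄/σ̲ + ᾱ σ̄ k / v̲²) / δ^{2/N})))`. -/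
def betaBound (b : Bounds) (N : ℕ) (lamBar : ℝ) (B : ℕ → ℝ) (C1 : ℝ) (k : ℕ) : ℝ :=
  Real.sqrt N * (lamBar * B k + C1 + b.C2 * Real.sqrt N *
    Real.sqrt (Real.log ((b.sigmaHi / b.sigmaLo + b.alphaHi * b.sigmaHi * k / b.vLo ^ 2) /
      b.delta ^ ((2 : ℝ) / N))))

/-- The standing assumptions on the environment, the sensors and the disturbance budget `B`. -/
structure Model.Admissible {I N m : ℕ} (M : Model I N m) (b : Bounds) (B : ℕ → ℝ) : Prop where
  /-- the propagation matrices are uniformly bounded from below and from above -/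
  propagation_bound : ∀ t k : ℕ, 0 < t → t ≤ k →
    LoewnerBetween b.alphaLo b.alphaHi ((propagation M.A t k)ᵀ * propagation M.A t k)
  budget_pos : ∀ K, 0 < B K
  budget_mono : Monotone B
  /-- the disturbances up to time `K` have total size at most `B K` -/
  budget : ∀ K, ∑ k ∈ Finset.range (K + 1), l2norm (M.dist k) ≤ B K
  /-- the `m` sensed positions are distinct -/
  sense_injective : ∀ i s, Function.Injective (M.sense i s)
  /-- an agent senses the position at which it is located -/
  sense_self : ∀ i s, s ∈ Set.range (M.sense i s)
  v_lo : ∀ i, b.vLo ≤ M.v i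
  v_hi : ∀ i, (M.v i : ℝ) ≤ b.vHi

/-- The noises `noise k` are i.i.d. with the Gaussian law of the model. The σ-algebra `ℱ k` is the
information before the measurement at time `k`: it contains the earlier noises and is independent
of the later ones. -/
structure IsNoise {I N m : ℕ} (M : Model I N m) {Ω : Type*} [MeasurableSpace Ω] (P : Measure Ω)
    (ℱ : Filtration ℕ ‹MeasurableSpace Ω›) (noise : ℕ → Ω → Fin I × Fin m → ℝ) : Prop where
  law : ∀ k, HasLaw (noise k) M.noiseLaw P
  adapted : ∀ k, Measurable[ℱ (k + 1)] (noise k)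
  indep : ∀ k, Indep (MeasurableSpace.comap (noise k) inferInstance) (ℱ k) P

/-- `pos` is a sequence of positions generated by the algorithm: positions are decided on the
available information only (the initial ones are arbitrary), and at each later time they maximize
the total value of the D-UCB. The maximizer need not be unique, and any one may be taken. -/
structure IsRun {I N m : ℕ} (M : Model I N m) {Ω : Type*} [MeasurableSpace Ω]
    (ℱ : Filtration ℕ ‹MeasurableSpace Ω›) (noise : ℕ → Ω → Fin I × Fin m → ℝ)
    (mean0 : Fin N → ℝ) (cov0 : Matrix (Fin N) (Fin N) ℝ) (lamBar : ℝ) (om beta : ℕ → ℝ)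
    (pos : ℕ → Ω → Fin I → Fin N) : Prop where
  adapted : ∀ k, Measurable[ℱ k] (pos k)
  maximizes : ∀ k w, ∀ q : Fin I → Fin N,
    let mu := ducb (kalmanFilter M mean0 cov0 lamBar om (fun t => pos t w) (fun t => noise t w)
      (k + 1)) (beta (k + 1))
    objective mu q ≤ objective mu (pos (k + 1) w)

end SourceSeeking

end

open SourceSeeking

/-! With `ω = 0` the filter is weighted recursive least squares. Pulled back to time 0 by `Φ_k = A_k
⋯ A_1`, its covariance is `Σ_k = Φ_k L_k⁻¹ Φ_kᵀ` with `L_k = Σ_0⁻¹ + ∑_{t<k} λ_t Φ_tᵀ Y_t Φ_t`, and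
its error is `Φ_k L_k⁻¹` applied to the sum of an initial error, a disturbance term and a noise term
(`kalmanFilter_path`). By Cauchy–Schwarz for `L_k⁻¹`, the error at `s` is at most `√Σ_k(s,s)` times
the `L_k⁻¹`-norms of these three terms (`abs_mean_sub_state_le`).

The initial term contributes `C₁`. The weights satisfy `λ_t ‖Y_t‖_{Σ_t} ≤ λ̄`, so the disturbances
contribute at most `λ̄ B_k` (`sqrt_disturbanceSum_le`). The noise is handled by the method of
mixtures: `det(L_k)^{-1/2} exp(S_kᵀ L_k⁻¹ S_k / 2)` is a supermartingale, and Ville's inequality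
bounds it for all `k ≤ K` at once, outside an event of probability `δ`
(`measure_selfNormalized_le`). The rest of the argument is deterministic.

On the good event the D-UCB is optimistic, so a round costs at most `2 β_k ∑ √Σ_k(s,s)` over the
occupied positions (`regret_le_of_optimistic`). With the gain `x_k = λ_k tr(Y_k Σ_k)`, each width is
of order `√x_k + x_k / λ̄` (`sqrt_filterCov_le`), and a log-determinant potential gives `∑ x_k ≲ N²
log K` (`sum_infoGain_le`). For `λ̄ = √N / B_K` one has `β_k ≲ N log K`. The square roots then sum
to `N · N√K`, the linear terms to `N · N² B_K / √N`, up to logarithms.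

The logarithm prescribed in `β_k` can be smaller than the one needed for `log det L_k`. For `k`
beyond a constant the two differ by at most a factor 2, which the spare factor `N` in `β_k` absorbs
when `N ≥ 2` (`confidence_radius_le`); the finitely many earlier rounds are bounded trivially. For
`N ≤ 1` the regret vanishes. -/

/-! ### Quadratic forms and determinants of positive semidefinite matrices. -/

section Quadratic

variable {n : Type*} [Fintype n]

theorem dotProduct_transpose_mul_self_mulVec {r : Type*} [Fintype r] (B : Matrix r n ℝ)
    (x y : n → ℝ) : x ⬝ᵥ (Bᵀ * B) *ᵥ y = (B *ᵥ x) ⬝ᵥ (B *ᵥ y) := by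
  rw [← Matrix.mulVec_mulVec, Matrix.dotProduct_mulVec, Matrix.vecMul_transpose]

theorem dotProduct_sq_le (x y : n → ℝ) : (x ⬝ᵥ y) ^ 2 ≤ (x ⬝ᵥ x) * (y ⬝ᵥ y) := by
  have := Finset.sum_mul_sq_le_sq_mul_sq Finset.univ x y
  simpa [dotProduct, sq] using this

theorem l2norm_sq {N : ℕ} (x : Fin N → ℝ) : l2norm x ^ 2 = x ⬝ᵥ x := by
  rw [l2norm, EuclideanSpace.norm_sq_eq]
  simp [dotProduct, sq]

theorem l2norm_nonneg {N : ℕ} (x : Fin N → ℝ) : 0 ≤ l2norm x := norm_nonneg _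

theorem l2norm_eq_sqrt {N : ℕ} (x : Fin N → ℝ) : l2norm x = √(x ⬝ᵥ x) := by
  rw [← l2norm_sq, Real.sqrt_sq (l2norm_nonneg x)]

theorem Matrix.PosSemidef.real_dotProduct_mulVec_nonneg {P : Matrix n n ℝ} (hP : P.PosSemidef)
    (x : n → ℝ) : 0 ≤ x ⬝ᵥ P *ᵥ x := by
  simpa using hP.dotProduct_mulVec_nonneg x

variable [DecidableEq n]

theorem Matrix.PosSemidef.exists_eq_transpose_mul_self {P : Matrix n n ℝ} (hP : P.PosSemidef) :
    ∃ B : Matrix n n ℝ, P = Bᵀ * B := by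
  open scoped MatrixOrder in
  obtain ⟨B, hB⟩ := CStarAlgebra.nonneg_iff_eq_star_mul_self.mp hP.nonneg
  exact ⟨B, by rw [hB, Matrix.star_eq_conjTranspose, Matrix.conjTranspose_eq_transpose_of_trivial]⟩

theorem Matrix.PosSemidef.cauchy_schwarz {P : Matrix n n ℝ} (hP : P.PosSemidef) (x y : n → ℝ) :
    (x ⬝ᵥ P *ᵥ y) ^ 2 ≤ (x ⬝ᵥ P *ᵥ x) * (y ⬝ᵥ P *ᵥ y) := by
  obtain ⟨B, rfl⟩ := hP.exists_eq_transpose_mul_self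
  simp only [dotProduct_transpose_mul_self_mulVec]
  exact dotProduct_sq_le _ _

theorem Matrix.PosDef.isUnit_det_real {P : Matrix n n ℝ} (hP : P.PosDef) : IsUnit P.det :=
  hP.det_pos.ne'.isUnit

theorem Matrix.PosDef.cauchy_schwarz_inv {P : Matrix n n ℝ} (hP : P.PosDef) (x y : n → ℝ) :
    (x ⬝ᵥ y) ^ 2 ≤ (x ⬝ᵥ P⁻¹ *ᵥ x) * (y ⬝ᵥ P *ᵥ y) := by
  have h := hP.inv.posSemidef.cauchy_schwarz x (P *ᵥ y)
  rw [Matrix.mulVec_mulVec, Matrix.nonsing_inv_mul _ hP.isUnit_det_real, Matrix.one_mulVec,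
    dotProduct_comm (P *ᵥ y)] at h
  exact h

/-- With `y = Q⁻¹ x`, Cauchy–Schwarz gives `(x·y)² ≤ (xᵀP⁻¹x)(yᵀPy)`, and `yᵀPy ≤ yᵀQy = x·y`; one
factor `x·y` cancels. -/
theorem Matrix.PosDef.inv_antitone {P Q : Matrix n n ℝ} (hP : P.PosDef)
    (hPQ : (Q - P).PosSemidef) (x : n → ℝ) : x ⬝ᵥ Q⁻¹ *ᵥ x ≤ x ⬝ᵥ P⁻¹ *ᵥ x := by
  have hQ : Q.PosDef := by simpa using hP.add_posSemidef hPQ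
  set y := Q⁻¹ *ᵥ x
  have h1 := hP.cauchy_schwarz_inv x y
  have h2 : y ⬝ᵥ Q *ᵥ y = x ⬝ᵥ y := by
    rw [Matrix.mulVec_mulVec, Matrix.mul_nonsing_inv _ hQ.isUnit_det_real, Matrix.one_mulVec,
      dotProduct_comm]
  have h3 := hPQ.real_dotProduct_mulVec_nonneg y
  rw [Matrix.sub_mulVec, dotProduct_sub] at h3
  have h4 := hP.inv.posSemidef.real_dotProduct_mulVec_nonneg x
  have h5 : 0 ≤ x ⬝ᵥ y := hQ.inv.posSemidef.real_dotProduct_mulVec_nonneg x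
  by_contra! hlt
  have : (x ⬝ᵥ y) ^ 2 ≤ (x ⬝ᵥ P⁻¹ *ᵥ x) * (x ⬝ᵥ y) :=
    h1.trans (mul_le_mul_of_nonneg_left (by linarith) h4)
  nlinarith

theorem Matrix.PosSemidef.sqrt_add_le {P : Matrix n n ℝ} (hP : P.PosSemidef) (x y : n → ℝ) :
    √((x + y) ⬝ᵥ P *ᵥ (x + y)) ≤ √(x ⬝ᵥ P *ᵥ x) + √(y ⬝ᵥ P *ᵥ y) := by
  obtain ⟨B, rfl⟩ := hP.exists_eq_transpose_mul_self
  have key : ∀ z : n → ℝ, √(z ⬝ᵥ (Bᵀ * B) *ᵥ z) = ‖WithLp.toLp 2 (B *ᵥ z)‖ := by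
    intro z
    rw [dotProduct_transpose_mul_self_mulVec, EuclideanSpace.norm_eq]
    simp [dotProduct, sq]
  rw [key, key, key, Matrix.mulVec_add, WithLp.toLp_add]
  exact norm_add_le _ _

theorem one_add_sum_le_prod_one_add {ι : Type*} (s : Finset ι) (f : ι → ℝ) (hf : ∀ i, 0 ≤ f i) :
    1 + ∑ i ∈ s, f i ≤ ∏ i ∈ s, (1 + f i) := by
  classical
  induction s using Finset.induction_on with
  | empty => simp
  | insert a s ha ih =>
    rw [Finset.sum_insert ha, Finset.prod_insert ha]
    have := hf a
    have := Finset.sum_nonneg fun i (_ : i ∈ s) => hf i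
    nlinarith

theorem Matrix.IsHermitian.det_one_add {P : Matrix n n ℝ} (hP : P.IsHermitian) :
    (1 + P).det = ∏ i, (1 + hP.eigenvalues i) := by
  have h : (1 + P) = Unitary.conjStarAlgAut ℝ _ hP.eigenvectorUnitary
      (1 + Matrix.diagonal (RCLike.ofReal ∘ hP.eigenvalues)) := by
    rw [map_add, map_one, ← hP.spectral_theorem]
  rw [h, Unitary.conjStarAlgAut_apply, Matrix.det_mul_right_comm]
  rw [← Matrix.diagonal_one, Matrix.diagonal_add]
  simp [Matrix.det_diagonal]

theorem Matrix.PosSemidef.one_add_trace_le_det {P : Matrix n n ℝ} (hP : P.PosSemidef) :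
    1 + P.trace ≤ (1 + P).det := by
  rw [hP.isHermitian.det_one_add, hP.isHermitian.trace_eq_sum_eigenvalues]
  exact one_add_sum_le_prod_one_add _ _ hP.eigenvalues_nonneg

/-- Writing `P = BᵀB` makes `P + R` congruent to `1 + Q` with `Q` positive semidefinite and `tr Q =
tr(P⁻¹R)`; expanding `∏ (1 + eigenvalue)` gives `det(1 + Q) ≥ 1 + tr Q`. This drives the
log-determinant potential. -/
theorem Matrix.PosDef.det_mul_one_add_trace_le {P R : Matrix n n ℝ} (hP : P.PosDef)
    (hR : R.PosSemidef) : P.det * (1 + (P⁻¹ * R).trace) ≤ (P + R).det := by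
  obtain ⟨B, hB⟩ := hP.posSemidef.exists_eq_transpose_mul_self
  have hd : P.det = B.det * B.det := by rw [hB, Matrix.det_mul, Matrix.det_transpose]
  have hBu : IsUnit B.det := by
    have := hP.det_pos
    rw [hd] at this
    exact (left_ne_zero_of_mul this.ne').isUnit
  have hBtu : IsUnit (Bᵀ).det := by rwa [Matrix.det_transpose]
  set Q := (B⁻¹)ᵀ * R * B⁻¹ with hQ
  have hQp : Q.PosSemidef := by
    simpa [Matrix.conjTranspose_eq_transpose_of_trivial] using hR.conjTranspose_mul_mul_same B⁻¹
  have hfac : P + R = Bᵀ * (1 + Q) * B := by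
    rw [hQ, Matrix.transpose_nonsing_inv, Matrix.mul_add, Matrix.mul_one, Matrix.add_mul, ← hB]
    congr 1
    simp only [Matrix.mul_assoc]
    rw [Matrix.nonsing_inv_mul _ hBu, Matrix.mul_one, ← Matrix.mul_assoc,
      Matrix.mul_nonsing_inv _ hBtu, Matrix.one_mul]
  have htr : (P⁻¹ * R).trace = Q.trace := by
    rw [hQ, hB, Matrix.mul_inv_rev, Matrix.transpose_nonsing_inv, Matrix.mul_assoc,
      Matrix.trace_mul_comm]
  rw [hfac, Matrix.det_mul, Matrix.det_mul, Matrix.det_transpose, hd, htr]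
  have := hQp.one_add_trace_le_det
  nlinarith [mul_self_nonneg B.det]

theorem Matrix.IsHermitian.eigenvalue_rayleigh {P : Matrix n n ℝ} (hP : P.IsHermitian) (i : n) :
    ∃ x : n → ℝ, x ⬝ᵥ x = 1 ∧ x ⬝ᵥ P *ᵥ x = hP.eigenvalues i := by
  refine ⟨⇑(hP.eigenvectorBasis i), ?_, ?_⟩
  · have := hP.eigenvectorBasis.orthonormal.1 i
    rw [EuclideanSpace.norm_eq, Real.sqrt_eq_one] at this
    simpa [dotProduct, sq] using this
  · rw [hP.eigenvalues_eq]; simp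

theorem Matrix.PosSemidef.det_le_pow {P : Matrix n n ℝ} (hP : P.PosSemidef) {c : ℝ}
    (h : ∀ x, x ⬝ᵥ P *ᵥ x ≤ c * (x ⬝ᵥ x)) : P.det ≤ c ^ Fintype.card n := by
  rw [hP.isHermitian.det_eq_prod_eigenvalues, ← Finset.card_univ, ← Finset.prod_const]
  refine Finset.prod_le_prod (fun i _ => hP.eigenvalues_nonneg i) fun i _ => ?_
  obtain ⟨x, hx, hxi⟩ := hP.isHermitian.eigenvalue_rayleigh i
  have := h x
  rw [hx, hxi, mul_one] at this
  exact this

theorem Matrix.IsHermitian.pow_le_det {P : Matrix n n ℝ} (hP : P.IsHermitian) {c : ℝ} (hc : 0 ≤ c)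
    (h : ∀ x, c * (x ⬝ᵥ x) ≤ x ⬝ᵥ P *ᵥ x) : c ^ Fintype.card n ≤ P.det := by
  rw [hP.det_eq_prod_eigenvalues, ← Finset.card_univ, ← Finset.prod_const]
  refine Finset.prod_le_prod (fun i _ => hc) fun i _ => ?_
  obtain ⟨x, hx, hxi⟩ := hP.eigenvalue_rayleigh i
  have := h x
  rw [hx, hxi, mul_one] at this
  exact this

theorem quadratic_bounds_of_loewner {N : ℕ} {lo hi : ℝ} {X : Matrix (Fin N) (Fin N) ℝ}
    (h : LoewnerBetween lo hi X) (x : Fin N → ℝ) :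
    lo * (x ⬝ᵥ x) ≤ x ⬝ᵥ X *ᵥ x ∧ x ⬝ᵥ X *ᵥ x ≤ hi * (x ⬝ᵥ x) := by
  have h1 := h.1.real_dotProduct_mulVec_nonneg x
  have h2 := h.2.real_dotProduct_mulVec_nonneg x
  simp only [Matrix.sub_mulVec, dotProduct_sub, Matrix.smul_mulVec, Matrix.one_mulVec,
    dotProduct_smul, smul_eq_mul] at h1 h2
  constructor <;> linarith

theorem posDef_of_loewner {N : ℕ} {lo hi : ℝ} {X : Matrix (Fin N) (Fin N) ℝ} (hlo : 0 < lo)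
    (h : LoewnerBetween lo hi X) : X.PosDef := by
  have := (Matrix.PosDef.one.smul hlo).add_posSemidef h.1
  simpa using this

theorem quadratic_inv_le {P : Matrix n n ℝ} (hP : P.PosDef) {c : ℝ} (hc : 0 < c)
    (h : ∀ x, c * (x ⬝ᵥ x) ≤ x ⬝ᵥ P *ᵥ x) (x : n → ℝ) : x ⬝ᵥ P⁻¹ *ᵥ x ≤ c⁻¹ * (x ⬝ᵥ x) := by
  set y := P⁻¹ *ᵥ x
  have h1 : y ⬝ᵥ P *ᵥ y = x ⬝ᵥ y := by
    rw [Matrix.mulVec_mulVec, Matrix.mul_nonsing_inv _ hP.isUnit_det_real, Matrix.one_mulVec,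
      dotProduct_comm]
  have h2 := h y
  have h3 := dotProduct_sq_le x y
  have h4 : 0 ≤ x ⬝ᵥ y := hP.inv.posSemidef.real_dotProduct_mulVec_nonneg x
  have h5 : 0 ≤ x ⬝ᵥ x := by simpa using Matrix.PosSemidef.one.real_dotProduct_mulVec_nonneg x
  rw [h1] at h2
  rw [← div_eq_inv_mul, le_div_iff₀ hc]
  by_contra! hlt
  have : c * (x ⬝ᵥ y) ^ 2 ≤ (x ⬝ᵥ x) * (x ⬝ᵥ y) := by nlinarith
  nlinarith

theorem le_quadratic_inv {P : Matrix n n ℝ} (hP : P.PosDef) {c : ℝ} (hc : 0 < c)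
    (h : ∀ x, x ⬝ᵥ P *ᵥ x ≤ c * (x ⬝ᵥ x)) (x : n → ℝ) : c⁻¹ * (x ⬝ᵥ x) ≤ x ⬝ᵥ P⁻¹ *ᵥ x := by
  have h1 := hP.cauchy_schwarz_inv x x
  have h2 := h x
  have h3 := hP.inv.posSemidef.real_dotProduct_mulVec_nonneg x
  have h5 : 0 ≤ x ⬝ᵥ x := by simpa using Matrix.PosSemidef.one.real_dotProduct_mulVec_nonneg x
  rw [← div_eq_inv_mul, div_le_iff₀ hc]
  by_contra! hlt
  have : (x ⬝ᵥ x) ^ 2 ≤ (x ⬝ᵥ P⁻¹ *ᵥ x) * (c * (x ⬝ᵥ x)) :=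
    h1.trans (mul_le_mul_of_nonneg_left h2 h3)
  have hpos : 0 < x ⬝ᵥ x := by nlinarith
  nlinarith

end Quadratic

/-! ### The Gaussian mixture and its one-step supermartingale property. -/

section Mixture

open scoped ENNReal

variable {n : Type*} [Fintype n]

theorem lintegral_exp_neg_dotProduct_ne_top :
    ∫⁻ x : n → ℝ, ENNReal.ofReal (Real.exp (-(x ⬝ᵥ x) / 2)) ≠ ∞ := by
  have h : Integrable (fun x : n → ℝ => ∏ i, Real.exp (-(1 / 2) * x i ^ 2)) :=
    Integrable.fintype_prod (f := fun _ (t : ℝ) => Real.exp (-(1 / 2) * t ^ 2))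
      fun _ => integrable_exp_neg_mul_sq (by norm_num)
  have h2 : ∀ x : n → ℝ, ∏ i, Real.exp (-(1 / 2) * x i ^ 2) = Real.exp (-(x ⬝ᵥ x) / 2) := by
    intro x
    rw [← Real.exp_sum, ← Finset.mul_sum]
    congr 1
    simp only [dotProduct, sq]
    ring
  simp only [h2] at h
  exact (Integrable.lintegral_lt_top h).ne

theorem lintegral_exp_neg_dotProduct_ne_zero :
    ∫⁻ x : n → ℝ, ENNReal.ofReal (Real.exp (-(x ⬝ᵥ x) / 2)) ≠ 0 := by
  intro h
  rw [lintegral_eq_zero_iff (by unfold dotProduct; fun_prop)] at h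
  have hE : ∀ x : n → ℝ, ENNReal.ofReal (Real.exp (-(x ⬝ᵥ x) / 2)) ≠ 0 := fun x => by
    simp [Real.exp_pos]
  have : ∀ᵐ x : n → ℝ, False := h.mono fun x hx => hE x hx
  simp only [Filter.eventually_false_iff_eq_bot, ae_eq_bot] at this
  exact NeZero.ne (volume : Measure (n → ℝ)) this

theorem posSemidef_weighted_gram {r : Type*} [Fintype r] [DecidableEq r] (v : r → ℝ≥0)
    (H : Matrix r n ℝ) :
    (Hᵀ * (Matrix.diagonal fun i => (v i : ℝ))⁻¹ * H).PosSemidef := by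
  have h : (Matrix.diagonal fun i => (v i : ℝ)).PosSemidef :=
    Matrix.PosSemidef.diagonal fun i => (v i).2
  simpa [Matrix.conjTranspose_eq_transpose_of_trivial] using h.inv.conjTranspose_mul_mul_same H

variable [DecidableEq n]

/-- Up to a constant factor, the integral over `ξ` of `exp (⟨ξ, S⟩ - ⟨ξ, M ξ⟩ / 2)`. -/
noncomputable def mixture (M : Matrix n n ℝ) (S : n → ℝ) : ℝ :=
  (√M.det)⁻¹ * Real.exp ((S ⬝ᵥ M⁻¹ *ᵥ S) / 2)

/-- Complete the square at `a = M⁻¹S` and substitute `B(x - a)` with `M = BᵀB`; the Jacobian is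
`|det B|⁻¹ = (det M)^{-1/2}`. The remaining Gaussian integral is never evaluated: being finite and
nonzero, it cancels. -/
theorem lintegral_exp_quadratic {M : Matrix n n ℝ} (hM : M.PosDef) (S : n → ℝ) :
    ∫⁻ x : n → ℝ, ENNReal.ofReal (Real.exp (x ⬝ᵥ S - (x ⬝ᵥ M *ᵥ x) / 2)) =
      ENNReal.ofReal (mixture M S) *
        ∫⁻ x : n → ℝ, ENNReal.ofReal (Real.exp (-(x ⬝ᵥ x) / 2)) := by
  obtain ⟨B, hB⟩ := hM.posSemidef.exists_eq_transpose_mul_self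
  have hd : M.det = B.det * B.det := by rw [hB, Matrix.det_mul, Matrix.det_transpose]
  have hB0 : B.det ≠ 0 := by
    have := hM.det_pos
    rw [hd] at this
    exact left_ne_zero_of_mul this.ne'
  have hsq : √M.det = |B.det| := by rw [hd, Real.sqrt_mul_self_eq_abs]
  have hMt : Mᵀ = M := by rw [hB]; simp
  set a := M⁻¹ *ᵥ S with ha
  have hMa : M *ᵥ a = S := by
    rw [ha, Matrix.mulVec_mulVec, Matrix.mul_nonsing_inv _ hM.isUnit_det_real, Matrix.one_mulVec]
  have hsym : ∀ x : n → ℝ, a ⬝ᵥ M *ᵥ x = S ⬝ᵥ x := by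
    intro x
    rw [Matrix.dotProduct_mulVec, ← Matrix.mulVec_transpose, hMt, hMa]
  have hexp : ∀ x : n → ℝ, x ⬝ᵥ S - (x ⬝ᵥ M *ᵥ x) / 2 =
      (S ⬝ᵥ a) / 2 + -((B *ᵥ (x - a)) ⬝ᵥ (B *ᵥ (x - a))) / 2 := by
    intro x
    rw [← dotProduct_transpose_mul_self_mulVec, ← hB, Matrix.mulVec_sub, hMa, sub_dotProduct,
      dotProduct_sub, dotProduct_sub, hsym, dotProduct_comm a S, dotProduct_comm S x]
    ring
  let g : (n → ℝ) → ℝ≥0∞ := fun x => ENNReal.ofReal (Real.exp (-(x ⬝ᵥ x) / 2))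
  have hg : Measurable g := by unfold g dotProduct; fun_prop
  have h1 : ∀ x : n → ℝ, ENNReal.ofReal (Real.exp (x ⬝ᵥ S - (x ⬝ᵥ M *ᵥ x) / 2)) =
      ENNReal.ofReal (Real.exp ((S ⬝ᵥ a) / 2)) * g (B *ᵥ (x - a)) := by
    intro x
    rw [hexp, Real.exp_add, ENNReal.ofReal_mul (Real.exp_pos _).le]
  simp only [h1]
  rw [lintegral_const_mul' _ _ ENNReal.ofReal_ne_top,
    lintegral_sub_right_eq_self (fun x => g (B *ᵥ x)) a]
  have h2 : ∫⁻ x : n → ℝ, g (B *ᵥ x) = ∫⁻ x, g x ∂(Measure.map (Matrix.toLin' B) volume) := by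
    rw [lintegral_map hg (Matrix.toLin' B).continuous_on_pi.measurable]
    rfl
  rw [h2, Real.map_matrix_volume_pi_eq_smul_volume_pi hB0, lintegral_smul_measure, smul_eq_mul,
    ← mul_assoc, ← ENNReal.ofReal_mul (Real.exp_pos _).le, mixture, hsq, abs_inv, mul_comm]
  rw [mul_comm (Real.exp _)]
  exact mul_comm _ _

theorem lintegral_exp_gaussian {r : Type*} [Fintype r] (v : r → ℝ≥0) (c : r → ℝ) :
    ∫⁻ y : r → ℝ, ENNReal.ofReal (Real.exp (c ⬝ᵥ y)) ∂(Measure.pi fun i => gaussianReal 0 (v i)) =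
      ENNReal.ofReal (Real.exp (∑ i, v i * c i ^ 2 / 2)) := by
  have h : ∀ y : r → ℝ, Real.exp (c ⬝ᵥ y) = ∏ i, Real.exp (c i * y i) := fun y => by
    rw [← Real.exp_sum]; rfl
  simp only [h]
  rw [← ofReal_integral_eq_lintegral_ofReal, integral_fintype_prod_eq_prod
    (f := fun i (x : ℝ) => Real.exp (c i * x)), Real.exp_sum]
  · congr 1
    refine Finset.prod_congr rfl fun i _ => ?_
    have := congrFun (mgf_fun_id_gaussianReal (μ := 0) (v := v i)) (c i)
    rw [mgf] at this
    rw [this]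
    simp
  · exact Integrable.fintype_prod (f := fun i (x : ℝ) => Real.exp (c i * x))
      fun i => integrable_exp_mul_gaussianReal (c i)
  · exact Filter.Eventually.of_forall fun y => Finset.prod_nonneg fun i _ => (Real.exp_pos _).le

theorem inv_diagonal_pos {r : Type*} [Fintype r] [DecidableEq r] {v : r → ℝ≥0}
    (hv : ∀ i, 0 < v i) : (Matrix.diagonal fun i => (v i : ℝ))⁻¹ =
      Matrix.diagonal fun i => (v i : ℝ)⁻¹ := by
  refine Matrix.inv_eq_right_inv ?_
  rw [Matrix.diagonal_mul_diagonal, ← Matrix.diagonal_one]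
  congr 1
  ext i
  have := hv i
  exact mul_inv_cancel₀ (by positivity)

/-- After exchanging the integrals, fix `ξ` and put `h = ξᵀHᵀV⁻¹Hξ`. The Gaussian moment generating
function contributes `exp(λ²h/2)`, the growth of the precision contributes `exp(-λh/2)`, and `λ² ≤
λ` on `[0, 1]`. -/
theorem lintegral_mixture_update_le {r : Type*} [Fintype r] [DecidableEq r] {M : Matrix n n ℝ}
    (hM : M.PosDef) (S : n → ℝ) {v : r → ℝ≥0} (hv : ∀ i, 0 < v i) (H : Matrix r n ℝ) {lam : ℝ}
    (h0 : 0 ≤ lam) (h1 : lam ≤ 1) :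
    ∫⁻ y : r → ℝ, ENNReal.ofReal (mixture
        (M + lam • (Hᵀ * (Matrix.diagonal fun i => (v i : ℝ))⁻¹ * H))
        (S + lam • (Hᵀ * (Matrix.diagonal fun i => (v i : ℝ))⁻¹) *ᵥ y))
        ∂(Measure.pi fun i => gaussianReal 0 (v i)) ≤ ENNReal.ofReal (mixture M S) := by
  set W := (Matrix.diagonal fun i => (v i : ℝ))⁻¹ with hW
  set c := ∫⁻ x : n → ℝ, ENNReal.ofReal (Real.exp (-(x ⬝ᵥ x) / 2))
  have hM' : (M + lam • (Hᵀ * W * H)).PosDef :=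
    hM.add_posSemidef ((posSemidef_weighted_gram v H).smul h0)
  rw [← ENNReal.mul_le_mul_iff_left (lintegral_exp_neg_dotProduct_ne_zero (n := n))
    (lintegral_exp_neg_dotProduct_ne_top (n := n)),
    ← lintegral_mul_const' _ _ (lintegral_exp_neg_dotProduct_ne_top (n := n))]
  simp only [← lintegral_exp_quadratic hM', ← lintegral_exp_quadratic hM]
  rw [lintegral_lintegral_swap]
  · refine lintegral_mono fun x => ?_
    have hsplit : ∀ y : r → ℝ, x ⬝ᵥ (S + lam • (Hᵀ * W) *ᵥ y) -
        (x ⬝ᵥ (M + lam • (Hᵀ * W * H)) *ᵥ x) / 2 = (x ⬝ᵥ S - (x ⬝ᵥ M *ᵥ x) / 2 +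
          -(lam * ∑ i, (v i : ℝ)⁻¹ * (H *ᵥ x) i ^ 2) / 2) +
          (fun i => lam * (v i : ℝ)⁻¹ * (H *ᵥ x) i) ⬝ᵥ y := by
      intro y
      have e1 : ∀ y : r → ℝ, x ⬝ᵥ (Hᵀ * W) *ᵥ y =
          ∑ i, (v i : ℝ)⁻¹ * (H *ᵥ x) i * y i := by
        intro y
        rw [← Matrix.mulVec_mulVec, Matrix.dotProduct_mulVec, Matrix.vecMul_transpose, hW,
          inv_diagonal_pos hv]
        simp only [dotProduct, Matrix.mulVec_diagonal]
        exact Finset.sum_congr rfl fun i _ => by ring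
      have e2 : x ⬝ᵥ (Hᵀ * W * H) *ᵥ x = ∑ i, (v i : ℝ)⁻¹ * (H *ᵥ x) i ^ 2 := by
        rw [← Matrix.mulVec_mulVec, e1]
        exact Finset.sum_congr rfl fun i _ => by ring
      have e3 : (fun i => lam * (v i : ℝ)⁻¹ * (H *ᵥ x) i) ⬝ᵥ y =
          lam * ∑ i, (v i : ℝ)⁻¹ * (H *ᵥ x) i * y i := by
        rw [dotProduct, Finset.mul_sum]
        exact Finset.sum_congr rfl fun i _ => by ring
      rw [dotProduct_add, dotProduct_smul, e1, Matrix.add_mulVec, Matrix.smul_mulVec,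
        dotProduct_add, dotProduct_smul, e2, e3]
      simp only [smul_eq_mul]
      ring
    simp only [hsplit, Real.exp_add _ (_ ⬝ᵥ _)]
    simp only [ENNReal.ofReal_mul (Real.exp_pos _).le]
    rw [lintegral_const_mul' _ _ ENNReal.ofReal_ne_top, lintegral_exp_gaussian,
      ← ENNReal.ofReal_mul (Real.exp_pos _).le, ← Real.exp_add]
    refine ENNReal.ofReal_le_ofReal (Real.exp_le_exp.mpr ?_)
    have hs : ∑ i, (v i : ℝ) * (lam * (v i : ℝ)⁻¹ * (H *ᵥ x) i) ^ 2 / 2 ≤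
        lam * (∑ i, (v i : ℝ)⁻¹ * (H *ᵥ x) i ^ 2) / 2 := by
      rw [Finset.mul_sum, Finset.sum_div]
      refine Finset.sum_le_sum fun i _ => ?_
      have hvi : (0 : ℝ) < v i := hv i
      have hid : (v i : ℝ) * (lam * (v i : ℝ)⁻¹ * (H *ᵥ x) i) ^ 2 / 2 =
          lam * (lam * ((v i : ℝ)⁻¹ * (H *ᵥ x) i ^ 2)) / 2 := by
        field_simp
      rw [hid]
      have hn : 0 ≤ (v i : ℝ)⁻¹ * (H *ᵥ x) i ^ 2 := by positivity
      have : lam * ((v i : ℝ)⁻¹ * (H *ᵥ x) i ^ 2) ≤ (v i : ℝ)⁻¹ * (H *ᵥ x) i ^ 2 := by nlinarith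
      nlinarith
    linarith
  · refine Measurable.aemeasurable ?_
    refine ENNReal.measurable_ofReal.comp (Real.measurable_exp.comp ?_)
    refine Continuous.measurable ?_
    simp only [dotProduct, Matrix.mulVec, Pi.add_apply, Pi.smul_apply]
    fun_prop

end Mixture

/-! ### Ville's inequality, integration of independent noise, measurability. -/

section Probability

open scoped ENNReal

variable {Ω : Type*} {mΩ : MeasurableSpace Ω} {P : Measure Ω}

/-- **Ville's inequality** over a finite horizon. -/
theorem mul_measure_exists_le_lintegral (ℱ : Filtration ℕ mΩ) {f : ℕ → Ω → ℝ≥0∞}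
    (hf : ∀ k, Measurable[ℱ k] (f k))
    (hstep : ∀ k s, MeasurableSet[ℱ k] s → ∫⁻ w in s, f (k + 1) w ∂P ≤ ∫⁻ w in s, f k w ∂P)
    (c : ℝ≥0∞) (K : ℕ) : c * P {w | ∃ k ≤ K, c ≤ f k w} ≤ ∫⁻ w, f 0 w ∂P := by
  have hle : ∀ k, MeasurableSet[ℱ k] {w | c ≤ f k w} := fun k =>
    hf k measurableSet_Ici
  have hH : ∀ K, MeasurableSet[ℱ K] {w | ∃ k ≤ K, c ≤ f k w} := by
    intro K
    have : {w | ∃ k ≤ K, c ≤ f k w} = ⋃ k ∈ Set.Iic K, {w | c ≤ f k w} := by ext; simp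
    rw [this]
    exact MeasurableSet.biUnion (Set.to_countable _) fun k hk => ℱ.mono hk _ (hle k)
  -- The induction needs this stronger form, which keeps the mass of `f K` on the event that the
  -- level has not yet been reached.
  suffices h : c * P {w | ∃ k ≤ K, c ≤ f k w} + ∫⁻ w in {w | ∃ k ≤ K, c ≤ f k w}ᶜ, f K w ∂P ≤
      ∫⁻ w, f 0 w ∂P from le_self_add.trans h
  induction K with
  | zero =>
    have h0 := ℱ.le 0 _ (hH 0)
    have h1 : c * P {w | ∃ k ≤ 0, c ≤ f k w} ≤ ∫⁻ w in {w | ∃ k ≤ 0, c ≤ f k w}, f 0 w ∂P := by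
      rw [← setLIntegral_const]
      exact setLIntegral_mono' h0 fun w hw => by simpa using hw
    exact (add_le_add h1 le_rfl).trans_eq (lintegral_add_compl _ h0)
  | succ K ih =>
    refine le_trans ?_ ih
    set H := {w | ∃ k ≤ K, c ≤ f k w} with hHdef
    have hHm : MeasurableSet H := ℱ.le K _ (hH K)
    have hDm : MeasurableSet {w | c ≤ f (K + 1) w} := ℱ.le _ _ (hle (K + 1))
    have hsplit : {w | ∃ k ≤ K + 1, c ≤ f k w} = H ∪ (Hᶜ ∩ {w | c ≤ f (K + 1) w}) := by
      rw [Set.union_inter_distrib_left, Set.union_compl_self, Set.univ_inter]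
      ext w
      simp only [hHdef, Set.mem_ofPred_eq, Set.mem_union, Nat.le_succ_iff, or_and_right, exists_or,
        exists_eq_left]
    have hcompl : {w | ∃ k ≤ K + 1, c ≤ f k w}ᶜ = Hᶜ ∩ {w | c ≤ f (K + 1) w}ᶜ := by
      rw [hsplit, Set.union_inter_distrib_left, Set.union_compl_self, Set.univ_inter,
        Set.compl_union]
    rw [hcompl, hsplit, measure_union (Set.disjoint_left.mpr fun w hw h => h.1 hw)
      (hHm.compl.inter hDm), mul_add, add_assoc]
    gcongr
    calc c * P (Hᶜ ∩ {w | c ≤ f (K + 1) w}) + ∫⁻ w in Hᶜ ∩ {w | c ≤ f (K + 1) w}ᶜ, f (K + 1) w ∂P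
        ≤ ∫⁻ w in Hᶜ ∩ {w | c ≤ f (K + 1) w}, f (K + 1) w ∂P +
          ∫⁻ w in Hᶜ ∩ {w | c ≤ f (K + 1) w}ᶜ, f (K + 1) w ∂P := by
          gcongr
          rw [← setLIntegral_const]
          exact setLIntegral_mono' (hHm.compl.inter hDm) fun w hw => hw.2
      _ = ∫⁻ w in Hᶜ, f (K + 1) w ∂P := by
          rw [← Set.sdiff_eq]
          exact lintegral_inter_add_sdiff _ _ hDm
      _ ≤ ∫⁻ w in Hᶜ, f K w ∂P := hstep K _ (hH K).compl

theorem lintegral_comp_prodMk_of_indepFun {Ω' E : Type*} [MeasurableSpace Ω'] [MeasurableSpace E]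
    [IsFiniteMeasure P] {Z : Ω → Ω'} {X : Ω → E} (hZ : Measurable Z) (hX : Measurable X)
    (h : IndepFun Z X P) {g : Ω' → E → ℝ≥0∞} (hg : Measurable (Function.uncurry g)) :
    ∫⁻ w, g (Z w) (X w) ∂P = ∫⁻ w, ∫⁻ y, g (Z w) y ∂(P.map X) ∂P := by
  have h1 := (indepFun_iff_map_prod_eq_prod_map_map hZ.aemeasurable hX.aemeasurable).mp h
  calc ∫⁻ w, g (Z w) (X w) ∂P = ∫⁻ p, Function.uncurry g p ∂(P.map fun w => (Z w, X w)) := by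
        rw [lintegral_map hg (hZ.prodMk hX)]; rfl
    _ = ∫⁻ z, ∫⁻ y, g z y ∂(P.map X) ∂(P.map Z) := by
        rw [h1, lintegral_prod _ hg.aemeasurable]; rfl
    _ = _ := by
        rw [lintegral_map (Measurable.lintegral_prod_right hg) hZ]

theorem setLIntegral_comp_prodMk_of_indepFun {Ω' E : Type*} [MeasurableSpace Ω']
    [MeasurableSpace E] [IsFiniteMeasure P] {Z : Ω → Ω'} {X : Ω → E} (hZ : Measurable Z)
    (hX : Measurable X) (h : IndepFun Z X P) {g : Ω' → E → ℝ≥0∞}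
    (hg : Measurable (Function.uncurry g)) {s : Set Ω'} (hs : MeasurableSet s) :
    ∫⁻ w in Z ⁻¹' s, g (Z w) (X w) ∂P = ∫⁻ w in Z ⁻¹' s, ∫⁻ y, g (Z w) y ∂(P.map X) ∂P := by
  have hg' : Measurable (Function.uncurry fun w y => s.indicator (fun _ => g w y) w) := by
    have : (Function.uncurry fun w y => s.indicator (fun _ => g w y) w) =
        (Prod.fst ⁻¹' s).indicator (Function.uncurry g) := by
      ext p
      by_cases hp : p.1 ∈ s <;> simp [Function.uncurry, hp]
    rw [this]
    exact hg.indicator (measurable_fst hs)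
  have key := lintegral_comp_prodMk_of_indepFun hZ hX h hg'
  rw [← lintegral_indicator (hZ hs), ← lintegral_indicator (hZ hs)]
  convert key using 2
  · ext w
    by_cases hw : w ∈ Z ⁻¹' s
    · simp [hw, Set.mem_preimage.mp hw]
    · have : Z w ∉ s := hw
      simp [this]
  · ext w
    by_cases hw : w ∈ Z ⁻¹' s
    · simp [hw, Set.mem_preimage.mp hw]
    · have : Z w ∉ s := hw
      simp [this]

/-- The identity, seen as a map from `(Ω, mΩ)` to `(Ω, m)`, is a random variable independent of `X`;
this reduces a sub-σ-algebra to the case of two independent variables. -/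
theorem setLIntegral_of_indep {Ω E : Type*} {m mΩ : MeasurableSpace Ω} {P : Measure Ω}
    [mE : MeasurableSpace E] [IsFiniteMeasure P] (hm : m ≤ mΩ) {X : Ω → E} (hX : Measurable X)
    (h : Indep (MeasurableSpace.comap X mE) m P) {g : Ω → E → ℝ≥0∞}
    (hg : Measurable[m.prod mE] (Function.uncurry g)) {s : Set Ω} (hs : MeasurableSet[m] s) :
    ∫⁻ w in s, g w (X w) ∂P = ∫⁻ w in s, ∫⁻ y, g w y ∂(P.map X) ∂P := by
  have hid : Measurable[mΩ, m] (id : Ω → Ω) := fun t ht => hm t ht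
  have hind : @IndepFun Ω Ω E mΩ m mE id X P := by
    refine (@IndepFun_iff_Indep Ω Ω E mΩ m mE id X P).mpr ?_
    rw [MeasurableSpace.comap_id]
    exact h.symm
  exact @setLIntegral_comp_prodMk_of_indepFun Ω mΩ P Ω E m mE _ id X hid hX hind g hg s hs

/-- Because `β` is finite, no regularity of `g` is needed. Hence matrices computed recursively from
the positions are measurable even for the discrete σ-algebra, and any function of them is
measurable. -/
theorem measurable_of_forall_preimage {Ω α β γ : Type*} {m : MeasurableSpace Ω} [Finite β]
    [MeasurableSpace β] [MeasurableSingletonClass β] {X : Ω → α} {Y : Ω → β}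
    (hX : Measurable[m, ⊤] X) (hY : Measurable[m] Y) (g : α → β → γ) :
    Measurable[m, ⊤] fun w => g (X w) (Y w) := by
  intro T _
  have : (fun w => g (X w) (Y w)) ⁻¹' T =
      ⋃ b, (X ⁻¹' {a | g a b ∈ T}) ∩ (Y ⁻¹' {b}) := by
    ext w; simp
  rw [this]
  exact MeasurableSet.iUnion fun b =>
    (hX MeasurableSpace.measurableSet_top).inter (hY (measurableSet_singleton b))

end Probability

/-! ### The filter in closed form, pulled back to time 0. -/

section FilterPath

theorem propagation_one_zero {N : ℕ} (A : ℕ → Matrix (Fin N) (Fin N) ℝ) :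
    propagation A 1 0 = 1 := by simp [propagation]

theorem propagation_one_succ {N : ℕ} (A : ℕ → Matrix (Fin N) (Fin N) ℝ) (k : ℕ) :
    propagation A 1 (k + 1) = A (k + 1) * propagation A 1 k := by simp [propagation]

theorem weightedNorm_nonneg {N : ℕ} (S Y : Matrix (Fin N) (Fin N) ℝ) : 0 ≤ weightedNorm S Y :=
  Real.sqrt_nonneg _

theorem adaptiveWeight_nonneg {N : ℕ} {lamBar : ℝ} (h : 0 ≤ lamBar)
    (S Y : Matrix (Fin N) (Fin N) ℝ) : 0 ≤ adaptiveWeight lamBar S Y :=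
  le_min zero_le_one (div_nonneg h (weightedNorm_nonneg S Y))

theorem adaptiveWeight_le_one {N : ℕ} (lamBar : ℝ) (S Y : Matrix (Fin N) (Fin N) ℝ) :
    adaptiveWeight lamBar S Y ≤ 1 := min_le_left _ _

theorem adaptiveWeight_mul_weightedNorm_le {N : ℕ} {lamBar : ℝ} (h : 0 ≤ lamBar)
    (S Y : Matrix (Fin N) (Fin N) ℝ) : adaptiveWeight lamBar S Y * weightedNorm S Y ≤ lamBar := by
  rcases (weightedNorm_nonneg S Y).eq_or_lt with h0 | h0
  · rw [← h0, mul_zero]; exact h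
  · exact (mul_le_mul_of_nonneg_right (min_le_right _ _) h0.le).trans_eq
      (div_mul_cancel₀ _ h0.ne')

variable {I N m : ℕ} (M : Model I N m)

/-- The measurement matrix at time `k`, seen from the state at time `0`. -/
def pulledBackMeas (k : ℕ) (p : Fin I → Fin N) : Matrix (Fin I × Fin m) (Fin N) ℝ :=
  M.measMatrix p * propagation M.A 1 k

/-- The inverse of the filter covariance at time `k`, pulled back to time `0`. -/
noncomputable def precision (cov0 : Matrix (Fin N) (Fin N) ℝ) (lamBar : ℝ)
    (pos : ℕ → Fin I → Fin N) : ℕ → Matrix (Fin N) (Fin N) ℝ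
  | 0 => cov0⁻¹
  | k + 1 => precision cov0 lamBar pos k +
      adaptiveWeight lamBar
        (propagation M.A 1 k * (precision cov0 lamBar pos k)⁻¹ * (propagation M.A 1 k)ᵀ)
        (M.infoMatrix (pos k)) •
      ((pulledBackMeas M k (pos k))ᵀ * (M.noiseCov)⁻¹ * pulledBackMeas M k (pos k))

/-- The covariance of the filter at time `k`. -/
noncomputable def filterCov (cov0 : Matrix (Fin N) (Fin N) ℝ) (lamBar : ℝ)
    (pos : ℕ → Fin I → Fin N) (k : ℕ) : Matrix (Fin N) (Fin N) ℝ :=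
  propagation M.A 1 k * (precision M cov0 lamBar pos k)⁻¹ * (propagation M.A 1 k)ᵀ

/-- The weight of the measurement at time `k`. -/
noncomputable def filterWeight (cov0 : Matrix (Fin N) (Fin N) ℝ) (lamBar : ℝ)
    (pos : ℕ → Fin I → Fin N) (k : ℕ) : ℝ :=
  adaptiveWeight lamBar (filterCov M cov0 lamBar pos k) (M.infoMatrix (pos k))

/-- The accumulated weighted noise, pulled back to time `0`. -/
noncomputable def noiseSum (cov0 : Matrix (Fin N) (Fin N) ℝ) (lamBar : ℝ)
    (pos : ℕ → Fin I → Fin N) (noise : ℕ → Fin I × Fin m → ℝ) : ℕ → Fin N → ℝ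
  | 0 => 0
  | k + 1 => noiseSum cov0 lamBar pos noise k + filterWeight M cov0 lamBar pos k •
      ((pulledBackMeas M k (pos k))ᵀ * (M.noiseCov)⁻¹) *ᵥ noise k

/-- The accumulated weighted disturbance, pulled back to time `0`. -/
noncomputable def disturbanceSum (cov0 : Matrix (Fin N) (Fin N) ℝ) (lamBar : ℝ)
    (pos : ℕ → Fin I → Fin N) : ℕ → Fin N → ℝ
  | 0 => 0
  | k + 1 => disturbanceSum cov0 lamBar pos k + filterWeight M cov0 lamBar pos k •
      (propagation M.A 1 k)ᵀ *ᵥ (M.infoMatrix (pos k) *ᵥ (M.disturbedState k - M.state k))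

variable {M}

theorem precision_succ (cov0 : Matrix (Fin N) (Fin N) ℝ) (lamBar : ℝ)
    (pos : ℕ → Fin I → Fin N) (k : ℕ) :
    precision M cov0 lamBar pos (k + 1) = precision M cov0 lamBar pos k +
      filterWeight M cov0 lamBar pos k •
      ((pulledBackMeas M k (pos k))ᵀ * (M.noiseCov)⁻¹ * pulledBackMeas M k (pos k)) := rfl

theorem pulledBack_info (k : ℕ) (p : Fin I → Fin N) :
    (pulledBackMeas M k p)ᵀ * (M.noiseCov)⁻¹ * pulledBackMeas M k p =
      (propagation M.A 1 k)ᵀ * M.infoMatrix p * propagation M.A 1 k := by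
  simp only [pulledBackMeas, Model.infoMatrix, Matrix.transpose_mul, Matrix.mul_assoc]

theorem filterWeight_nonneg {cov0 : Matrix (Fin N) (Fin N) ℝ} {lamBar : ℝ} (h : 0 ≤ lamBar)
    (pos : ℕ → Fin I → Fin N) (k : ℕ) : 0 ≤ filterWeight M cov0 lamBar pos k :=
  adaptiveWeight_nonneg h _ _

theorem filterWeight_le_one (cov0 : Matrix (Fin N) (Fin N) ℝ) (lamBar : ℝ)
    (pos : ℕ → Fin I → Fin N) (k : ℕ) : filterWeight M cov0 lamBar pos k ≤ 1 :=
  adaptiveWeight_le_one _ _ _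

theorem precision_increment_posSemidef {cov0 : Matrix (Fin N) (Fin N) ℝ} {lamBar : ℝ}
    (h : 0 ≤ lamBar) (pos : ℕ → Fin I → Fin N) (k : ℕ) :
    (filterWeight M cov0 lamBar pos k •
      ((pulledBackMeas M k (pos k))ᵀ * (M.noiseCov)⁻¹ * pulledBackMeas M k (pos k))).PosSemidef :=
  (posSemidef_weighted_gram (fun r : Fin I × Fin m => M.v r.1) _).smul (filterWeight_nonneg h pos k)

theorem precision_posDef {cov0 : Matrix (Fin N) (Fin N) ℝ} (h0 : cov0.PosDef) {lamBar : ℝ}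
    (h : 0 ≤ lamBar) (pos : ℕ → Fin I → Fin N) (k : ℕ) :
    (precision M cov0 lamBar pos k).PosDef := by
  induction k with
  | zero => exact h0.inv
  | succ k ih => exact ih.add_posSemidef (precision_increment_posSemidef h pos k)

theorem precision_mono {cov0 : Matrix (Fin N) (Fin N) ℝ} {lamBar : ℝ}
    (h : 0 ≤ lamBar) (pos : ℕ → Fin I → Fin N) {j k : ℕ} (hjk : j ≤ k) :
    (precision M cov0 lamBar pos k - precision M cov0 lamBar pos j).PosSemidef := by
  induction k, hjk using Nat.le_induction with
  | base => rw [sub_self]; exact Matrix.PosSemidef.zero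
  | succ k _ ih =>
    rw [precision_succ, add_sub_right_comm]
    exact ih.add (precision_increment_posSemidef h pos k)

theorem isUnit_det_propagation {b : Bounds} (hb : b.Valid) {B : ℕ → ℝ} (hM : M.Admissible b B)
    (k : ℕ) : IsUnit (propagation M.A 1 k).det := by
  rcases Nat.eq_zero_or_pos k with rfl | hk
  · simp [propagation_one_zero]
  · have h := (posDef_of_loewner hb.alpha_pos (hM.propagation_bound 1 k one_pos hk)).det_pos
    rw [Matrix.det_mul] at h
    exact (right_ne_zero_of_mul h.ne').isUnit

theorem isUnit_det_transition {b : Bounds} (hb : b.Valid) {B : ℕ → ℝ} (hM : M.Admissible b B)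
    (k : ℕ) : IsUnit (M.A (k + 1)).det := by
  have h := isUnit_det_propagation hb hM (k + 1)
  rw [propagation_one_succ, Matrix.det_mul] at h
  exact isUnit_of_mul_isUnit_left h

theorem filterCov_posDef {b : Bounds} (hb : b.Valid) {B : ℕ → ℝ} (hM : M.Admissible b B)
    {cov0 : Matrix (Fin N) (Fin N) ℝ} (h0 : cov0.PosDef) {lamBar : ℝ}
    (h : 0 ≤ lamBar) (pos : ℕ → Fin I → Fin N) (k : ℕ) :
    (filterCov M cov0 lamBar pos k).PosDef := by
  have hu := isUnit_det_propagation hb hM k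
  have := (precision_posDef (M := M) h0 h pos k).inv.mul_mul_conjTranspose_same
    (B := propagation M.A 1 k) (Matrix.vecMul_injective_of_isUnit
      ((Matrix.isUnit_iff_isUnit_det _).mpr hu))
  rwa [Matrix.conjTranspose_eq_transpose_of_trivial] at this

/-- Conjugation by `Φ_k` turns the recursion into additions: the precision grows by `λ_k Φ_kᵀ Y_k
Φ_k`, the right-hand side by `λ_k Φ_kᵀ` applied to the weighted disturbance and noise. The
covariance and the weights involve only the positions, not the noise values. -/
theorem kalmanFilter_path {b : Bounds} (hb : b.Valid) {B : ℕ → ℝ} (hM : M.Admissible b B)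
    {cov0 : Matrix (Fin N) (Fin N) ℝ} (h0 : cov0.PosDef) {lamBar : ℝ}
    (h : 0 ≤ lamBar) (mean0 : Fin N → ℝ) (pos : ℕ → Fin I → Fin N)
    (noise : ℕ → Fin I × Fin m → ℝ) (k : ℕ) :
    (kalmanFilter M mean0 cov0 lamBar (fun _ => 0) pos noise k).cov =
        filterCov M cov0 lamBar pos k ∧
      (kalmanFilter M mean0 cov0 lamBar (fun _ => 0) pos noise k).mean - M.state k =
        propagation M.A 1 k *ᵥ ((precision M cov0 lamBar pos k)⁻¹ *ᵥ
          (cov0⁻¹ *ᵥ (mean0 - M.phi0) + disturbanceSum M cov0 lamBar pos k +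
            noiseSum M cov0 lamBar pos noise k)) := by
  induction k with
  | zero =>
    simp only [kalmanFilter, filterCov, precision, propagation_one_zero, Model.state,
      disturbanceSum, noiseSum, add_zero, Matrix.one_mulVec, Matrix.one_mul, Matrix.transpose_one,
      Matrix.mul_one]
    rw [Matrix.nonsing_inv_nonsing_inv _ h0.isUnit_det_real]
    refine ⟨rfl, ?_⟩
    rw [Matrix.mulVec_mulVec, Matrix.mul_nonsing_inv _ h0.isUnit_det_real, Matrix.one_mulVec]
  | succ k ih =>
    obtain ⟨ihc, ihm⟩ := ih
    set x := kalmanFilter M mean0 cov0 lamBar (fun _ => 0) pos noise k with hx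
    set Φ := propagation M.A 1 k with hΦ
    set L := precision M cov0 lamBar pos k with hL
    set L' := precision M cov0 lamBar pos (k + 1) with hL'
    set lam := filterWeight M cov0 lamBar pos k with hlam
    set Y := M.infoMatrix (pos k) with hY
    set A := M.A (k + 1) with hA
    have hΦu : IsUnit Φ.det := isUnit_det_propagation hb hM k
    have hΦtu : IsUnit (Φᵀ).det := by rwa [Matrix.det_transpose]
    have hAu : IsUnit (Aᵀ).det := by
      rw [Matrix.det_transpose]; exact isUnit_det_transition hb hM k
    have hLp : L.PosDef := precision_posDef h0 h pos k
    have hL'p : L'.PosDef := precision_posDef h0 h pos (k + 1)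
    have hLL' : L' = L + lam • (Φᵀ * Y * Φ) := by
      rw [hL', precision_succ, pulledBack_info]
    have hcovinv : x.cov⁻¹ = (Φᵀ)⁻¹ * L * Φ⁻¹ := by
      rw [ihc, filterCov, Matrix.mul_inv_rev, Matrix.mul_inv_rev,
        Matrix.nonsing_inv_nonsing_inv _ hLp.isUnit_det_real, Matrix.mul_assoc]
    have hsum : x.cov⁻¹ + lam • Y = (Φᵀ)⁻¹ * L' * Φ⁻¹ := by
      rw [hLL', Matrix.mul_add, Matrix.add_mul, hcovinv]
      congr 1
      rw [Matrix.mul_smul, Matrix.smul_mul]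
      congr 1
      simp only [Matrix.mul_assoc]
      rw [Matrix.mul_nonsing_inv _ hΦu, Matrix.mul_one, ← Matrix.mul_assoc,
        Matrix.nonsing_inv_mul _ hΦtu, Matrix.one_mul]
    set Ch := (x.cov⁻¹ + lam • Y)⁻¹ with hCh
    have hhalf : Ch = Φ * L'⁻¹ * Φᵀ := by
      rw [hCh, hsum, Matrix.mul_inv_rev, Matrix.mul_inv_rev, Matrix.nonsing_inv_nonsing_inv _ hΦu,
        Matrix.nonsing_inv_nonsing_inv _ hΦtu, Matrix.mul_assoc]
    have hChu : IsUnit Ch.det := by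
      rw [hhalf, Matrix.det_mul, Matrix.det_mul]
      exact (hΦu.mul hL'p.inv.isUnit_det_real).mul hΦtu
    have hw : adaptiveWeight lamBar x.cov Y = lam := by rw [ihc]; rfl
    have hdom : (fun _ : ℕ => (0 : ℝ)) k - prevWeight (fun _ => 0) k = 0 := by
      cases k <;> simp [prevWeight]
    have hstep : kalmanFilter M mean0 cov0 lamBar (fun _ => 0) pos noise (k + 1) =
        kalmanStep A Y (M.infoVector k (pos k) (noise k)) lam 0 x := by
      calc _ = kalmanStep A Y (M.infoVector k (pos k) (noise k)) (adaptiveWeight lamBar x.cov Y)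
            ((fun _ : ℕ => (0 : ℝ)) k - prevWeight (fun _ => 0) k) x := rfl
        _ = _ := by rw [hw, hdom]
    have hcovNext : A * (Ch⁻¹ + (0 : ℝ) • x.aux⁻¹)⁻¹ * Aᵀ = A * Ch * Aᵀ := by
      rw [zero_smul, add_zero, Matrix.nonsing_inv_nonsing_inv _ hChu]
    -- Without discounting, the prediction step only transports the mean by `A`.
    have hgain : A * Ch * Aᵀ * (Aᵀ)⁻¹ * Ch⁻¹ = A := by
      rw [Matrix.mul_assoc (A * Ch), Matrix.mul_nonsing_inv _ hAu, Matrix.mul_one,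
        Matrix.mul_assoc, Matrix.mul_nonsing_inv _ hChu, Matrix.mul_one]
    constructor
    · rw [hstep]
      simp only [kalmanStep]
      rw [← hCh, hcovNext, hhalf, filterCov, propagation_one_succ, Matrix.transpose_mul]
      simp only [Matrix.mul_assoc, ← hL', hΦ, hA]
    · set W := (M.measMatrix (pos k))ᵀ * (M.noiseCov)⁻¹ with hW
      set d := M.disturbedState k - M.state k with hd
      have hy : M.infoVector k (pos k) (noise k) = Y *ᵥ (M.state k + d) + W *ᵥ noise k := by
        rw [Model.infoVector, Model.measurement, Matrix.mulVec_add, Matrix.mulVec_mulVec, hd,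
          add_sub_cancel]
        rfl
      set u := cov0⁻¹ *ᵥ (mean0 - M.phi0) + disturbanceSum M cov0 lamBar pos k +
        noiseSum M cov0 lamBar pos noise k with hu
      have hu' : cov0⁻¹ *ᵥ (mean0 - M.phi0) + disturbanceSum M cov0 lamBar pos (k + 1) +
          noiseSum M cov0 lamBar pos noise (k + 1) =
          u + lam • Φᵀ *ᵥ (Y *ᵥ d + W *ᵥ noise k) := by
        have hpw : (pulledBackMeas M k (pos k))ᵀ * (M.noiseCov)⁻¹ = Φᵀ * W := by
          rw [pulledBackMeas, Matrix.transpose_mul, hW, Matrix.mul_assoc]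
        simp only [disturbanceSum, noiseSum, hpw, hu, Matrix.mulVec_add, smul_add,
          ← Matrix.mulVec_mulVec, ← hlam, ← hd, ← hY, ← hΦ]
        abel
      have hmean : x.mean = M.state k + Φ *ᵥ (L⁻¹ *ᵥ u) := by
        rw [← ihm, add_sub_cancel]
      -- Apply `L'⁻¹` to `L' L⁻¹ u = u + λ Φᵀ Y Φ L⁻¹ u`; the last term is what the innovation
      -- subtracts.
      have hLu : L⁻¹ *ᵥ u = L'⁻¹ *ᵥ u + lam • L'⁻¹ *ᵥ (Φᵀ *ᵥ (Y *ᵥ (Φ *ᵥ (L⁻¹ *ᵥ u)))) := by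
        have e : u + lam • Φᵀ *ᵥ (Y *ᵥ (Φ *ᵥ (L⁻¹ *ᵥ u))) = L' *ᵥ (L⁻¹ *ᵥ u) := by
          rw [hLL', Matrix.add_mulVec, Matrix.mulVec_mulVec u L,
            Matrix.mul_nonsing_inv _ hLp.isUnit_det_real, Matrix.one_mulVec, Matrix.smul_mulVec,
            ← Matrix.mulVec_mulVec, ← Matrix.mulVec_mulVec]
        rw [← Matrix.mulVec_smul, ← Matrix.mulVec_add, e, Matrix.mulVec_mulVec,
          Matrix.nonsing_inv_mul _ hL'p.isUnit_det_real, Matrix.one_mulVec]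
      rw [hstep, hu']
      simp only [kalmanStep]
      rw [← hCh, hcovNext, hgain, hy, propagation_one_succ]
      simp only [Model.state, ← hΦ, ← hA]
      rw [← Matrix.mulVec_sub, ← Matrix.mulVec_mulVec _ A Φ]
      congr 1
      rw [hmean, hhalf, ← Matrix.mulVec_mulVec, ← Matrix.mulVec_mulVec]
      have e2 : Y *ᵥ (M.state k + d) + W *ᵥ noise k - Y *ᵥ (M.state k + Φ *ᵥ (L⁻¹ *ᵥ u)) =
          (Y *ᵥ d + W *ᵥ noise k) - Y *ᵥ (Φ *ᵥ (L⁻¹ *ᵥ u)) := by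
        simp only [Matrix.mulVec_add]; abel
      rw [e2]
      set g := Y *ᵥ d + W *ᵥ noise k
      rw [add_sub_right_comm, add_sub_cancel_left, ← Matrix.mulVec_smul, ← Matrix.mulVec_add]
      congr 1
      generalize Y *ᵥ (Φ *ᵥ (L⁻¹ *ᵥ u)) = w at hLu ⊢
      rw [hLu]
      simp only [Matrix.mulVec_sub, Matrix.mulVec_add, smul_sub, Matrix.mulVec_smul]
      abel

end FilterPath

/-! ### Self-normalized concentration of the noise. -/

section SelfNormalized

open scoped ENNReal

theorem measurable_mulVec_of_entries {α r n : Type*} {_ : MeasurableSpace α} [Fintype r]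
    {X : α → Matrix n r ℝ} (hX : ∀ i j, Measurable fun a => X a i j) {V : α → r → ℝ}
    (hV : Measurable V) : Measurable fun a => X a *ᵥ V a := by
  refine measurable_pi_lambda _ fun i => ?_
  simp only [Matrix.mulVec, dotProduct]
  exact Finset.measurable_fun_sum _ fun j _ => (hX i j).mul ((measurable_pi_apply j).comp hV)

theorem measurable_add_mulVec_of_entries {α r n : Type*} {_ : MeasurableSpace α} [Fintype r]
    {U : α → n → ℝ} (hU : Measurable U) {X : α → Matrix n r ℝ}
    (hX : ∀ i j, Measurable fun a => X a i j) {V : α → r → ℝ}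
    (hV : Measurable V) : Measurable fun a => U a + X a *ᵥ V a :=
  hU.add (measurable_mulVec_of_entries hX hV)

theorem measurable_mixture {α n : Type*} {_ : MeasurableSpace α} [Fintype n] [DecidableEq n]
    {X : α → Matrix n n ℝ} (hd : Measurable fun a => (X a).det)
    (hX : ∀ i j, Measurable fun a => (X a)⁻¹ i j) {V : α → n → ℝ} (hV : Measurable V) :
    Measurable fun a => mixture (X a) (V a) := by
  have h := measurable_mulVec_of_entries hX hV
  have h2 : Measurable fun a => V a ⬝ᵥ (X a)⁻¹ *ᵥ V a := by
    simp only [dotProduct]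
    exact Finset.measurable_fun_sum _ fun j _ =>
      ((measurable_pi_apply j).comp hV).mul ((measurable_pi_apply j).comp h)
  unfold mixture
  fun_prop

variable {I N m : ℕ} {M : Model I N m} {Ω : Type*} {mΩ : MeasurableSpace Ω} {P : Measure Ω}
  {ℱ : Filtration ℕ mΩ} {pos : ℕ → Ω → Fin I → Fin N}

theorem measurable_precision (hpos : ∀ k, Measurable[ℱ k] (pos k))
    (cov0 : Matrix (Fin N) (Fin N) ℝ) (lamBar : ℝ) (k : ℕ) :
    Measurable[ℱ k, ⊤] fun w => precision M cov0 lamBar (fun t => pos t w) k := by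
  induction k with
  | zero => exact measurable_const
  | succ k ih =>
    exact (measurable_of_forall_preimage ih (hpos k) fun L p => L + adaptiveWeight lamBar
      (propagation M.A 1 k * L⁻¹ * (propagation M.A 1 k)ᵀ) (M.infoMatrix p) •
      ((pulledBackMeas M k p)ᵀ * (M.noiseCov)⁻¹ * pulledBackMeas M k p)).mono
        (ℱ.mono k.le_succ) le_rfl

/-- The precision is known one step ahead, because it uses positions only; hence the noise of time
`k` can be integrated out with `L_{k+1}` frozen. -/
theorem measurable_precision_succ (hpos : ∀ k, Measurable[ℱ k] (pos k))
    (cov0 : Matrix (Fin N) (Fin N) ℝ) (lamBar : ℝ) (k : ℕ) :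
    Measurable[ℱ k, ⊤] fun w => precision M cov0 lamBar (fun t => pos t w) (k + 1) :=
  measurable_of_forall_preimage (measurable_precision hpos cov0 lamBar k) (hpos k)
    fun L p => L + adaptiveWeight lamBar
      (propagation M.A 1 k * L⁻¹ * (propagation M.A 1 k)ᵀ) (M.infoMatrix p) •
      ((pulledBackMeas M k p)ᵀ * (M.noiseCov)⁻¹ * pulledBackMeas M k p)

theorem measurable_noise_gain (hpos : ∀ k, Measurable[ℱ k] (pos k))
    (cov0 : Matrix (Fin N) (Fin N) ℝ) (lamBar : ℝ) (k : ℕ) :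
    Measurable[ℱ k, ⊤] fun w => filterWeight M cov0 lamBar (fun t => pos t w) k •
      ((pulledBackMeas M k (pos k w))ᵀ * (M.noiseCov)⁻¹) :=
  measurable_of_forall_preimage (measurable_precision hpos cov0 lamBar k) (hpos k)
    fun L p => adaptiveWeight lamBar
      (propagation M.A 1 k * L⁻¹ * (propagation M.A 1 k)ᵀ) (M.infoMatrix p) •
      ((pulledBackMeas M k p)ᵀ * (M.noiseCov)⁻¹)

theorem noiseSum_succ (cov0 : Matrix (Fin N) (Fin N) ℝ) (lamBar : ℝ)
    (p : ℕ → Fin I → Fin N) (x : ℕ → Fin I × Fin m → ℝ) (k : ℕ) :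
    noiseSum M cov0 lamBar p x (k + 1) = noiseSum M cov0 lamBar p x k +
      (filterWeight M cov0 lamBar p k • ((pulledBackMeas M k (p k))ᵀ * (M.noiseCov)⁻¹)) *ᵥ x k := by
  rw [Matrix.smul_mulVec]; rfl

theorem measurable_noiseSum (hpos : ∀ k, Measurable[ℱ k] (pos k))
    {noise : ℕ → Ω → Fin I × Fin m → ℝ} (hnoise : ∀ k, Measurable[ℱ (k + 1)] (noise k))
    (cov0 : Matrix (Fin N) (Fin N) ℝ) (lamBar : ℝ) (k : ℕ) :
    Measurable[ℱ k] fun w => noiseSum M cov0 lamBar (fun t => pos t w) (fun t => noise t w) k := by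
  induction k with
  | zero => exact measurable_const
  | succ k ih =>
    simp only [noiseSum_succ]
    refine measurable_add_mulVec_of_entries (ih.mono (ℱ.mono k.le_succ) le_rfl)
      (fun i j => ?_) (hnoise k)
    have h := (measurable_noise_gain (M := M) hpos cov0 lamBar k).mono (ℱ.mono k.le_succ) le_rfl
    exact (measurable_from_top (f := fun X : Matrix (Fin N) (Fin I × Fin m) ℝ => X i j)).comp h

/-- A time-uniform self-normalized concentration inequality for the accumulated noise. -/
theorem measure_selfNormalized_le [IsProbabilityMeasure P] (hpos : ∀ k, Measurable[ℱ k] (pos k))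
    {noise : ℕ → Ω → Fin I × Fin m → ℝ} (hn : IsNoise M P ℱ noise) (hv : ∀ i, 0 < M.v i)
    {cov0 : Matrix (Fin N) (Fin N) ℝ} (h0 : cov0.PosDef) {lamBar : ℝ} (hl : 0 ≤ lamBar)
    {δ : ℝ} (hδ : 0 < δ) (K : ℕ) :
    P {w | ∃ k ≤ K, mixture cov0⁻¹ 0 / δ ≤ mixture (precision M cov0 lamBar (fun t => pos t w) k)
      (noiseSum M cov0 lamBar (fun t => pos t w) (fun t => noise t w) k)} ≤ ENNReal.ofReal δ := by
  set F : ℕ → Ω → ℝ≥0∞ := fun k w =>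
    ENNReal.ofReal (mixture (precision M cov0 lamBar (fun t => pos t w) k)
      (noiseSum M cov0 lamBar (fun t => pos t w) (fun t => noise t w) k)) with hF
  have hFm : ∀ k, Measurable[ℱ k] (F k) := by
    intro k
    have hp := measurable_precision (M := M) hpos cov0 lamBar k
    exact ENNReal.measurable_ofReal.comp (measurable_mixture
      ((measurable_from_top (f := fun X : Matrix (Fin N) (Fin N) ℝ => X.det)).comp hp)
      (fun i j => (measurable_from_top
        (f := fun X : Matrix (Fin N) (Fin N) ℝ => X⁻¹ i j)).comp hp)
      (measurable_noiseSum hpos hn.adapted cov0 lamBar k))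
  have hstep : ∀ k s, MeasurableSet[ℱ k] s →
      ∫⁻ w in s, F (k + 1) w ∂P ≤ ∫⁻ w in s, F k w ∂P := by
    intro k s hs
    let g : Ω → (Fin I × Fin m → ℝ) → ℝ≥0∞ := fun w y =>
      ENNReal.ofReal (mixture (precision M cov0 lamBar (fun t => pos t w) (k + 1))
        (noiseSum M cov0 lamBar (fun t => pos t w) (fun t => noise t w) k +
          (filterWeight M cov0 lamBar (fun t => pos t w) k •
            ((pulledBackMeas M k (pos k w))ᵀ * (M.noiseCov)⁻¹)) *ᵥ y))
    have hX : Measurable (noise k) := (hn.adapted k).mono (ℱ.le _) le_rfl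
    have hg : Measurable[(ℱ k).prod inferInstance] (Function.uncurry g) := by
      have hfst : Measurable[(ℱ k).prod inferInstance, ℱ k]
          (Prod.fst : Ω × (Fin I × Fin m → ℝ) → Ω) := @measurable_fst _ _ (ℱ k) _
      have hsnd : Measurable[(ℱ k).prod inferInstance]
          (Prod.snd : Ω × (Fin I × Fin m → ℝ) → _) := @measurable_snd _ _ (ℱ k) _
      have hp := (measurable_precision_succ (M := M) hpos cov0 lamBar k).comp hfst
      have hq := (measurable_noise_gain (M := M) hpos cov0 lamBar k).comp hfst
      refine ENNReal.measurable_ofReal.comp (measurable_mixture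
        ((measurable_from_top (f := fun X : Matrix (Fin N) (Fin N) ℝ => X.det)).comp hp)
        (fun i j => (measurable_from_top
          (f := fun X : Matrix (Fin N) (Fin N) ℝ => X⁻¹ i j)).comp hp) ?_)
      exact measurable_add_mulVec_of_entries
        ((measurable_noiseSum hpos hn.adapted cov0 lamBar k).comp hfst) (fun i j => (measurable_from_top
        (f := fun X : Matrix (Fin N) (Fin I × Fin m) ℝ => X i j)).comp hq) hsnd
    have hFg : ∀ w, F (k + 1) w = g w (noise k w) := by
      intro w
      simp only [hF, g, noiseSum_succ]
    simp only [hFg]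
    rw [setLIntegral_of_indep (ℱ.le k) hX (hn.indep k) hg hs]
    refine lintegral_mono fun w => ?_
    rw [(hn.law k).map_eq]
    simp only [g, Matrix.smul_mulVec]
    exact lintegral_mixture_update_le (precision_posDef h0 hl _ k) _
      (v := fun r : Fin I × Fin m => M.v r.1) (fun r => hv r.1) (pulledBackMeas M k (pos k w))
      (filterWeight_nonneg hl _ k) (filterWeight_le_one _ _ _ k)
  -- The level is the deterministic initial value divided by `δ`, so Ville's inequality yields
  -- exactly `δ`.
  have hville := mul_measure_exists_le_lintegral ℱ hFm hstep
    (ENNReal.ofReal (mixture cov0⁻¹ 0 / δ)) K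
  have hm0 : 0 < mixture cov0⁻¹ (0 : Fin N → ℝ) := by
    have := h0.inv.det_pos
    unfold mixture; positivity
  have hF0 : ∫⁻ w, F 0 w ∂P = ENNReal.ofReal (mixture cov0⁻¹ 0 / δ) * ENNReal.ofReal δ := by
    rw [← ENNReal.ofReal_mul (by positivity), div_mul_cancel₀ _ hδ.ne']
    simp [hF, precision, noiseSum]
  rw [hF0, ENNReal.mul_le_mul_iff_right (by simpa using by positivity) ENNReal.ofReal_ne_top]
    at hville
  refine (measure_mono ?_).trans hville
  rintro w ⟨k, hk, hw⟩
  exact ⟨k, hk, ENNReal.ofReal_le_ofReal hw⟩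

end SelfNormalized

/-! ### The weighted matrix norm. -/

section WeightedNorm

variable {N : ℕ}

theorem sqrt_quadratic_mulVec_le_weightedNorm (S Y : Matrix (Fin N) (Fin N) ℝ) (d : Fin N → ℝ) :
    √((Y *ᵥ d) ⬝ᵥ S *ᵥ (Y *ᵥ d)) ≤ weightedNorm S Y * l2norm d := by
  set T := Matrix.toEuclideanCLM (n := Fin N) (𝕜 := ℝ) (Yᵀ * S * Y) with hT
  have h1 : (Y *ᵥ d) ⬝ᵥ S *ᵥ (Y *ᵥ d) = inner ℝ (WithLp.toLp 2 d) (T (WithLp.toLp 2 d)) := by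
    rw [hT, Matrix.toEuclideanCLM_toLp, EuclideanSpace.inner_toLp_toLp, dotProduct_comm,
      Matrix.mul_assoc, ← Matrix.mulVec_mulVec, ← Matrix.mulVec_mulVec]
    simp only [star_trivial]
    rw [dotProduct_comm (Yᵀ *ᵥ _), Matrix.dotProduct_mulVec d, Matrix.vecMul_transpose,
      dotProduct_comm]
  have h2 : (Y *ᵥ d) ⬝ᵥ S *ᵥ (Y *ᵥ d) ≤ ‖T‖ * l2norm d ^ 2 := by
    rw [h1]
    refine (real_inner_le_norm _ _).trans ?_
    have := T.le_opNorm (WithLp.toLp 2 d)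
    have hn := norm_nonneg (WithLp.toLp 2 d)
    rw [l2norm]
    nlinarith
  refine (Real.sqrt_le_sqrt h2).trans_eq ?_
  rw [Real.sqrt_mul (norm_nonneg _), Real.sqrt_sq (l2norm_nonneg d)]
  rfl

theorem l2norm_mulVec_sq_le (B : Matrix (Fin N) (Fin N) ℝ) (x : Fin N → ℝ) :
    (B *ᵥ x) ⬝ᵥ (B *ᵥ x) ≤ (Bᵀ * B).trace * (x ⬝ᵥ x) := by
  have h : ∀ i, (B *ᵥ x) i * (B *ᵥ x) i ≤ (∑ j, B i j * B i j) * (x ⬝ᵥ x) := by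
    intro i
    have := dotProduct_sq_le (B i) x
    simpa [Matrix.mulVec, sq, dotProduct] using this
  calc (B *ᵥ x) ⬝ᵥ (B *ᵥ x) ≤ ∑ i, (∑ j, B i j * B i j) * (x ⬝ᵥ x) :=
        Finset.sum_le_sum fun i _ => h i
    _ = _ := by
        rw [← Finset.sum_mul]
        congr 1
        rw [Finset.sum_comm]
        simp [Matrix.trace, Matrix.mul_apply]

/-- With `YᵀSY = CᵀC`, the Frobenius bound for `C` and for `Cᵀ` each costs a factor `√tr(CᵀC)`. -/
theorem weightedNorm_sq_le_trace {S : Matrix (Fin N) (Fin N) ℝ} (hS : S.PosSemidef)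
    (Y : Matrix (Fin N) (Fin N) ℝ) : weightedNorm S Y ^ 2 ≤ (Yᵀ * S * Y).trace := by
  have hP : (Yᵀ * S * Y).PosSemidef := by
    simpa [Matrix.conjTranspose_eq_transpose_of_trivial] using hS.conjTranspose_mul_mul_same Y
  rw [weightedNorm, Real.sq_sqrt (norm_nonneg _)]
  have htr := hP.trace_nonneg
  obtain ⟨C, hC⟩ := hP.exists_eq_transpose_mul_self
  rw [hC] at htr ⊢
  refine ContinuousLinearMap.opNorm_le_bound _ htr fun x => ?_
  refine le_of_sq_le_sq ?_ (mul_nonneg htr (norm_nonneg _))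
  have h1 := l2norm_mulVec_sq_le C x.ofLp
  have h2 := l2norm_mulVec_sq_le Cᵀ (C *ᵥ x.ofLp)
  rw [Matrix.transpose_transpose, Matrix.trace_mul_comm] at h2
  have h3 := h2.trans (mul_le_mul_of_nonneg_left h1 htr)
  rw [Matrix.mulVec_mulVec, ← l2norm_sq, ← l2norm_sq] at h3
  calc _ = l2norm ((Cᵀ * C) *ᵥ x.ofLp) ^ 2 := rfl
    _ ≤ _ := h3
    _ = _ := by rw [l2norm]; ring

end WeightedNorm

/-! ### Error bounds, information gain and its potential. -/

section ModelFacts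

variable {I N m : ℕ} {M : Model I N m} {b : Bounds} {B : ℕ → ℝ}

/-- The maximum with 1 covers `k = 0`, where the propagation matrix is the identity and the assumed
bounds say nothing. -/
theorem propagation_quadratic_le (hM : M.Admissible b B) (k : ℕ) (x : Fin N → ℝ) :
    (propagation M.A 1 k *ᵥ x) ⬝ᵥ (propagation M.A 1 k *ᵥ x) ≤ max 1 b.alphaHi * (x ⬝ᵥ x) := by
  have hx : 0 ≤ x ⬝ᵥ x := by simpa using Matrix.PosSemidef.one.real_dotProduct_mulVec_nonneg x
  rcases Nat.eq_zero_or_pos k with rfl | hk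
  · rw [propagation_one_zero, Matrix.one_mulVec]
    nlinarith [le_max_left 1 b.alphaHi]
  · have h := (quadratic_bounds_of_loewner (hM.propagation_bound 1 k one_pos hk) x).2
    rw [dotProduct_transpose_mul_self_mulVec] at h
    exact h.trans (mul_le_mul_of_nonneg_right (le_max_right _ _) hx)

theorem propagation_transpose_quadratic_le (hM : M.Admissible b B) (k : ℕ) (x : Fin N → ℝ) :
    ((propagation M.A 1 k)ᵀ *ᵥ x) ⬝ᵥ ((propagation M.A 1 k)ᵀ *ᵥ x) ≤
      max 1 b.alphaHi * (x ⬝ᵥ x) := by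
  set Φ := propagation M.A 1 k
  set y := Φᵀ *ᵥ x
  have h0 : ∀ z : Fin N → ℝ, 0 ≤ z ⬝ᵥ z := fun z => by
    simpa using Matrix.PosSemidef.one.real_dotProduct_mulVec_nonneg z
  have h1 : y ⬝ᵥ y = x ⬝ᵥ Φ *ᵥ y := by
    rw [Matrix.dotProduct_mulVec x, ← Matrix.mulVec_transpose]
  have h2 := dotProduct_sq_le x (Φ *ᵥ y)
  have h3 := propagation_quadratic_le hM k y
  rw [← h1] at h2
  by_contra! hlt
  have h4 : (y ⬝ᵥ y) ^ 2 ≤ (x ⬝ᵥ x) * (max 1 b.alphaHi * (y ⬝ᵥ y)) :=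
    h2.trans (mul_le_mul_of_nonneg_left h3 (h0 x))
  have h5 : 0 < y ⬝ᵥ y := lt_of_le_of_lt (mul_nonneg (by positivity) (h0 x)) hlt
  nlinarith

theorem state_eq_propagation (k : ℕ) : M.state k = propagation M.A 1 k *ᵥ M.phi0 := by
  induction k with
  | zero => simp [Model.state, propagation_one_zero]
  | succ k ih => rw [Model.state, ih, propagation_one_succ, Matrix.mulVec_mulVec]

theorem abs_apply_le_l2norm (x : Fin N → ℝ) (s : Fin N) : |x s| ≤ l2norm x := by
  rw [← Real.norm_eq_abs]
  exact PiLp.norm_apply_le (WithLp.toLp 2 x) s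

theorem abs_state_le (hM : M.Admissible b B) {ρ : ℝ} (hρ : l2norm M.phi0 ≤ ρ) (k : ℕ)
    (s : Fin N) : |M.state k s| ≤ √(max 1 b.alphaHi) * ρ := by
  refine (abs_apply_le_l2norm _ s).trans ?_
  rw [l2norm_eq_sqrt, state_eq_propagation]
  refine (Real.sqrt_le_sqrt (propagation_quadratic_le hM k _)).trans ?_
  rw [Real.sqrt_mul (by positivity), ← l2norm_eq_sqrt]
  gcongr

/-- The diagonal entries of `Y_k`. -/
noncomputable def infoCoeff (M : Model I N m) (p : Fin I → Fin N) (l : Fin N) : ℝ :=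
  ∑ r : Fin I × Fin m, if M.sense r.1 (p r.1) r.2 = l then (M.v r.1 : ℝ)⁻¹ else 0

theorem noise_var_pos (hb : b.Valid) (hM : M.Admissible b B) (i : Fin I) : 0 < M.v i := by
  have := hM.v_lo i
  have := hb.v_pos
  exact_mod_cast (by linarith : (0 : ℝ) < M.v i)

theorem infoMatrix_eq_diagonal (hb : b.Valid) (hM : M.Admissible b B) (p : Fin I → Fin N) :
    M.infoMatrix p = Matrix.diagonal (infoCoeff M p) := by
  rw [Model.infoMatrix, Model.noiseCov, inv_diagonal_pos (v := fun r : Fin I × Fin m => M.v r.1)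
    fun r => noise_var_pos hb hM r.1]
  ext i j
  rw [Matrix.mul_apply]
  simp only [Matrix.mul_diagonal, Matrix.transpose_apply, Model.measMatrix,
    Matrix.of_apply, Matrix.diagonal_apply, infoCoeff, ite_mul, mul_ite, one_mul, zero_mul, mul_one,
    mul_zero]
  by_cases h : i = j
  · subst h
    rw [if_pos rfl]
    exact Finset.sum_congr rfl fun r _ => by split_ifs <;> rfl
  · rw [if_neg h]
    refine Finset.sum_eq_zero fun r _ => ?_
    split_ifs with h1 h2
    · exact absurd (h2.symm.trans h1) h
    · rfl
    · rfl

theorem infoCoeff_nonneg (p : Fin I → Fin N) (l : Fin N) : 0 ≤ infoCoeff M p l :=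
  Finset.sum_nonneg fun r _ => by split_ifs <;> positivity

/-- Sensed positions are distinct, so each agent contributes at most one row for `l`; the bound does
not involve `m`. -/
theorem infoCoeff_le (hb : b.Valid) (hM : M.Admissible b B) (p : Fin I → Fin N) (l : Fin N) :
    infoCoeff M p l ≤ I / b.vLo := by
  have h : ∀ i : Fin I,
      ∑ j : Fin m, (if M.sense i (p i) j = l then (M.v i : ℝ)⁻¹ else 0) ≤ b.vLo⁻¹ := by
    intro i
    have hv : (M.v i : ℝ)⁻¹ ≤ b.vLo⁻¹ := inv_anti₀ hb.v_pos (hM.v_lo i)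
    by_cases hj : ∃ j, M.sense i (p i) j = l
    · obtain ⟨j, hj⟩ := hj
      rw [Finset.sum_eq_single j]
      · rwa [if_pos hj]
      · intro j' _ hne
        exact if_neg fun h => hne (hM.sense_injective i _ (h.trans hj.symm))
      · simp
    · rw [Finset.sum_eq_zero]
      · exact inv_nonneg.mpr hb.v_pos.le
      · intro j _
        exact if_neg fun h => hj ⟨j, h⟩
  rw [infoCoeff, Fintype.sum_prod_type]
  refine (Finset.sum_le_sum fun i _ => h i).trans_eq ?_
  simp [div_eq_mul_inv]

theorem inv_le_infoCoeff (hM : M.Admissible b B) (hb : b.Valid) {p : Fin I → Fin N} {l : Fin N}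
    (hl : l ∈ Finset.univ.image p) : b.vHi⁻¹ ≤ infoCoeff M p l := by
  obtain ⟨i, -, rfl⟩ := Finset.mem_image.mp hl
  obtain ⟨j, hj⟩ := hM.sense_self i (p i)
  have hv : b.vHi⁻¹ ≤ (M.v i : ℝ)⁻¹ := inv_anti₀ (noise_var_pos hb hM i) (hM.v_hi i)
  refine hv.trans ?_
  have := Finset.single_le_sum (f := fun r : Fin I × Fin m =>
    if M.sense r.1 (p r.1) r.2 = p i then (M.v r.1 : ℝ)⁻¹ else 0)
    (fun r _ => by split_ifs <;> positivity) (Finset.mem_univ (i, j))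
  simpa [hj, infoCoeff] using this

variable {cov0 : Matrix (Fin N) (Fin N) ℝ} {lamBar : ℝ}

theorem filterCov_quadratic (pos : ℕ → Fin I → Fin N) (k : ℕ) (x : Fin N → ℝ) :
    x ⬝ᵥ filterCov M cov0 lamBar pos k *ᵥ x = ((propagation M.A 1 k)ᵀ *ᵥ x) ⬝ᵥ
      (precision M cov0 lamBar pos k)⁻¹ *ᵥ ((propagation M.A 1 k)ᵀ *ᵥ x) := by
  rw [filterCov, ← Matrix.mulVec_mulVec, ← Matrix.mulVec_mulVec, Matrix.dotProduct_mulVec,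
    ← Matrix.mulVec_transpose]

theorem apply_eq_quadratic_single (S : Matrix (Fin N) (Fin N) ℝ) (s : Fin N) :
    S s s = Pi.single s 1 ⬝ᵥ S *ᵥ Pi.single s 1 := by
  simp

theorem filterCov_apply_nonneg (h0 : cov0.PosDef) (hl : 0 ≤ lamBar) (pos : ℕ → Fin I → Fin N)
    (k : ℕ) (s : Fin N) : 0 ≤ filterCov M cov0 lamBar pos k s s := by
  rw [apply_eq_quadratic_single (filterCov M cov0 lamBar pos k), filterCov_quadratic]
  exact (precision_posDef h0 hl pos k).inv.posSemidef.real_dotProduct_mulVec_nonneg _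

theorem filterCov_apply_le (hM : M.Admissible b B) (hb : b.Valid)
    (hc : LoewnerBetween b.sigmaLo b.sigmaHi cov0) (hl : 0 ≤ lamBar) (pos : ℕ → Fin I → Fin N)
    (k : ℕ) (s : Fin N) :
    filterCov M cov0 lamBar pos k s s ≤ b.sigmaHi * max 1 b.alphaHi := by
  have h0 := posDef_of_loewner hb.sigma_pos hc
  have hs : 0 < b.sigmaHi := hb.sigma_pos.trans_le hb.sigma_le
  rw [apply_eq_quadratic_single (filterCov M cov0 lamBar pos k), filterCov_quadratic]
  set z := (propagation M.A 1 k)ᵀ *ᵥ (Pi.single s 1 : Fin N → ℝ) with hz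
  have h1 := (precision_posDef (M := M) h0 hl pos 0).inv_antitone
    (precision_mono hl pos (Nat.zero_le k)) z
  have h2 : (precision M cov0 lamBar pos 0)⁻¹ = cov0 := by
    rw [precision, Matrix.nonsing_inv_nonsing_inv _ h0.isUnit_det_real]
  rw [h2] at h1
  have h3 := (quadratic_bounds_of_loewner hc z).2
  have h4 := propagation_transpose_quadratic_le hM k (Pi.single s 1)
  rw [← hz] at h4
  have h5 : (Pi.single s 1 : Fin N → ℝ) ⬝ᵥ Pi.single s 1 = 1 := by simp
  rw [h5, mul_one] at h4
  calc _ ≤ _ := h1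
    _ ≤ _ := h3
    _ ≤ _ := mul_le_mul_of_nonneg_left h4 hs.le

/-- The weighted information gained by the measurement at time `k`. -/
noncomputable def infoGain (M : Model I N m) (cov0 : Matrix (Fin N) (Fin N) ℝ) (lamBar : ℝ)
    (pos : ℕ → Fin I → Fin N) (k : ℕ) : ℝ :=
  filterWeight M cov0 lamBar pos k *
    ∑ l, infoCoeff M (pos k) l * filterCov M cov0 lamBar pos k l l

theorem infoGain_nonneg (h0 : cov0.PosDef) (hl : 0 ≤ lamBar) (pos : ℕ → Fin I → Fin N) (k : ℕ) :
    0 ≤ infoGain M cov0 lamBar pos k :=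
  mul_nonneg (filterWeight_nonneg hl pos k) (Finset.sum_nonneg fun l _ =>
    mul_nonneg (infoCoeff_nonneg _ l) (filterCov_apply_nonneg h0 hl pos k l))

theorem infoGain_le (hM : M.Admissible b B) (hb : b.Valid)
    (hc : LoewnerBetween b.sigmaLo b.sigmaHi cov0) (hl : 0 ≤ lamBar) (pos : ℕ → Fin I → Fin N)
    (k : ℕ) : infoGain M cov0 lamBar pos k ≤
      N * (I / b.vLo * (b.sigmaHi * max 1 b.alphaHi)) := by
  have h0 := posDef_of_loewner hb.sigma_pos hc
  have hsum : ∑ l, infoCoeff M (pos k) l * filterCov M cov0 lamBar pos k l l ≤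
      N * (I / b.vLo * (b.sigmaHi * max 1 b.alphaHi)) := by
    refine (Finset.sum_le_card_nsmul _ _ _ fun l _ => mul_le_mul (infoCoeff_le hb hM (pos k) l)
      (filterCov_apply_le hM hb hc hl pos k l) (filterCov_apply_nonneg h0 hl pos k l) ?_).trans_eq
      (by simp)
    have := hb.v_pos
    positivity
  have h1 : 0 ≤ ∑ l, infoCoeff M (pos k) l * filterCov M cov0 lamBar pos k l l :=
    Finset.sum_nonneg fun l _ =>
      mul_nonneg (infoCoeff_nonneg _ l) (filterCov_apply_nonneg h0 hl pos k l)
  exact (mul_le_of_le_one_left h1 (filterWeight_le_one _ _ _ k)).trans hsum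

theorem trace_diagonal_mul (y : Fin N → ℝ) (S : Matrix (Fin N) (Fin N) ℝ) :
    (Matrix.diagonal y * S).trace = ∑ l, y l * S l l := by
  simp [Matrix.trace, Matrix.diagonal_mul]

/-- The gain is the trace of `L_k⁻¹(L_{k+1} - L_k)`, the quantity that controls the growth of `det
L_k`. -/
theorem infoGain_eq_trace (hM : M.Admissible b B) (hb : b.Valid) (pos : ℕ → Fin I → Fin N)
    (k : ℕ) : infoGain M cov0 lamBar pos k = ((precision M cov0 lamBar pos k)⁻¹ *
      (filterWeight M cov0 lamBar pos k • ((pulledBackMeas M k (pos k))ᵀ * (M.noiseCov)⁻¹ *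
        pulledBackMeas M k (pos k)))).trace := by
  rw [infoGain, ← trace_diagonal_mul, ← infoMatrix_eq_diagonal hb hM, pulledBack_info,
    Matrix.mul_smul, Matrix.trace_smul, smul_eq_mul, filterCov]
  congr 1
  rw [Matrix.trace_mul_comm, Matrix.mul_assoc, Matrix.mul_assoc, Matrix.trace_mul_comm]
  simp only [Matrix.mul_assoc]

theorem div_one_add_le_log {x X : ℝ} (hx : 0 ≤ x) (hX : x ≤ X) : x / (1 + X) ≤ Real.log (1 + x) := by
  have h1 : 1 - (1 + x)⁻¹ ≤ Real.log (1 + x) := Real.one_sub_inv_le_log_of_pos (by linarith)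
  have h2 : x / (1 + X) ≤ x / (1 + x) := by gcongr
  have h3 : x / (1 + x) = 1 - (1 + x)⁻¹ := by
    have : (1 + x) ≠ 0 := by positivity
    field_simp; ring
  linarith

/-- Elliptical potential: `det L_{k+1} ≥ det L_k (1 + x_k)`, and `log(1 + x) ≥ x / (1 + X)` for `0 ≤
x ≤ X`. The uniform bound `X` on the gains is proportional to `N`, which costs one factor `N`. -/
theorem sum_infoGain_le_log_det (hM : M.Admissible b B) (hb : b.Valid)
    (hc : LoewnerBetween b.sigmaLo b.sigmaHi cov0) (hl : 0 ≤ lamBar) (pos : ℕ → Fin I → Fin N)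
    (n : ℕ) : ∑ k ∈ Finset.range n, infoGain M cov0 lamBar pos k ≤
      (1 + N * (I / b.vLo * (b.sigmaHi * max 1 b.alphaHi))) *
        (Real.log (precision M cov0 lamBar pos n).det - Real.log (cov0⁻¹).det) := by
  have h0 := posDef_of_loewner hb.sigma_pos hc
  have hX : 0 ≤ N * (I / b.vLo * (b.sigmaHi * max 1 b.alphaHi)) := by
    have := hb.v_pos
    have := hb.sigma_pos.trans_le hb.sigma_le
    positivity
  induction n with
  | zero => simp [precision]
  | succ n ih =>
    rw [Finset.sum_range_succ]
    have hp := precision_posDef (M := M) h0 hl pos n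
    have hx := infoGain_nonneg (M := M) h0 hl pos n
    have hdet := hp.det_mul_one_add_trace_le (precision_increment_posSemidef (M := M) (cov0 := cov0) hl pos n)
    rw [← infoGain_eq_trace hM hb, ← precision_succ] at hdet
    have hlog := Real.log_le_log (mul_pos hp.det_pos (by linarith)) hdet
    rw [Real.log_mul hp.det_pos.ne' (by linarith)] at hlog
    have hd := div_one_add_le_log hx (infoGain_le hM hb hc hl pos n)
    rw [div_le_iff₀ (by linarith)] at hd
    nlinarith

theorem precision_quadratic_le (hM : M.Admissible b B) (hb : b.Valid)
    (hc : LoewnerBetween b.sigmaLo b.sigmaHi cov0) (pos : ℕ → Fin I → Fin N)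
    (n : ℕ) (x : Fin N → ℝ) : x ⬝ᵥ precision M cov0 lamBar pos n *ᵥ x ≤
      (b.sigmaLo⁻¹ + max 1 b.alphaHi * (I / b.vLo) * n) * (x ⬝ᵥ x) := by
  induction n with
  | zero =>
    have := quadratic_inv_le (posDef_of_loewner hb.sigma_pos hc) hb.sigma_pos
      (fun x => (quadratic_bounds_of_loewner hc x).1) x
    simpa [precision] using this
  | succ n ih =>
    have hv := hb.v_pos
    rw [precision_succ, pulledBack_info, Matrix.add_mulVec, dotProduct_add, Matrix.smul_mulVec,
      dotProduct_smul, smul_eq_mul, ← Matrix.mulVec_mulVec, ← Matrix.mulVec_mulVec,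
      Matrix.dotProduct_mulVec x (propagation M.A 1 n)ᵀ, Matrix.vecMul_transpose]
    set z := propagation M.A 1 n *ᵥ x with hz
    have h1 : z ⬝ᵥ M.infoMatrix (pos n) *ᵥ z ≤ I / b.vLo * (z ⬝ᵥ z) := by
      rw [infoMatrix_eq_diagonal hb hM]
      simp only [dotProduct, Matrix.mulVec_diagonal, Finset.mul_sum]
      refine Finset.sum_le_sum fun l _ => ?_
      have := infoCoeff_le hb hM (pos n) l
      nlinarith [mul_self_nonneg (z l)]
    have h1' : 0 ≤ z ⬝ᵥ M.infoMatrix (pos n) *ᵥ z := by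
      rw [infoMatrix_eq_diagonal hb hM]
      simp only [dotProduct, Matrix.mulVec_diagonal]
      refine Finset.sum_nonneg fun l _ => ?_
      have := infoCoeff_nonneg (M := M) (pos n) l
      nlinarith [mul_self_nonneg (z l)]
    have h2 := propagation_quadratic_le hM n x
    rw [← hz] at h2
    have h3 := mul_le_of_le_one_left h1' (filterWeight_le_one (M := M) cov0 lamBar pos n)
    have h4 : (I / b.vLo) * (z ⬝ᵥ z) ≤ (I / b.vLo) * (max 1 b.alphaHi * (x ⬝ᵥ x)) :=
      mul_le_mul_of_nonneg_left h2 (by positivity)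
    push_cast
    linarith

theorem log_det_precision_le (hM : M.Admissible b B) (hb : b.Valid)
    (hc : LoewnerBetween b.sigmaLo b.sigmaHi cov0) (hl : 0 ≤ lamBar) (pos : ℕ → Fin I → Fin N)
    (n : ℕ) : Real.log (precision M cov0 lamBar pos n).det - Real.log (cov0⁻¹).det ≤
      N * Real.log (b.sigmaHi / b.sigmaLo + b.sigmaHi * (max 1 b.alphaHi * (I / b.vLo)) * n) := by
  have h0 := posDef_of_loewner hb.sigma_pos hc
  have hs : 0 < b.sigmaHi := hb.sigma_pos.trans_le hb.sigma_le
  have hs' := hb.sigma_pos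
  have hv := hb.v_pos
  have hp := precision_posDef (M := M) h0 hl pos n
  set c := b.sigmaLo⁻¹ + max 1 b.alphaHi * (I / b.vLo) * n
  have hcpos : 0 < c := by positivity
  have h1 := hp.posSemidef.det_le_pow (precision_quadratic_le hM hb hc pos n)
  have h2 := h0.inv.isHermitian.pow_le_det (inv_nonneg.mpr hs.le)
    (le_quadratic_inv h0 hs fun x => (quadratic_bounds_of_loewner hc x).2)
  rw [Fintype.card_fin] at h1 h2
  have h3 := Real.log_le_log hp.det_pos h1
  have h4 := Real.log_le_log (by positivity) h2
  rw [Real.log_pow] at h3 h4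
  have h5 : b.sigmaHi / b.sigmaLo + b.sigmaHi * (max 1 b.alphaHi * (I / b.vLo)) * n =
      b.sigmaHi * c := by simp only [c]; ring
  rw [h5, Real.log_mul hs.ne' hcpos.ne']
  rw [Real.log_inv] at h4
  linarith

/-- One summand for each value of the weight. If `λ = 1`, the term of `s` in `tr(YΣ)` gives `Σ(s,s)
≤ v̄ x`. If `λ = λ̄/‖Y‖_Σ`, testing the norm on the unit vector of `s` gives `√Σ(s,s) ≤ v̄ ‖Y‖_Σ`,
while `‖Y‖_Σ² ≤ tr(YΣY) ≤ (I/v̲) tr(YΣ)` gives `‖Y‖_Σ ≤ (I/v̲) x/λ̄`. -/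
theorem sqrt_filterCov_le (hM : M.Admissible b B) (hb : b.Valid) (h0 : cov0.PosDef)
    (hl : 0 < lamBar) (pos : ℕ → Fin I → Fin N) (k : ℕ) {s : Fin N}
    (hs : s ∈ Finset.univ.image (pos k)) : √(filterCov M cov0 lamBar pos k s s) ≤
      √(b.vHi * infoGain M cov0 lamBar pos k) +
        b.vHi * (I / b.vLo) / lamBar * infoGain M cov0 lamBar pos k := by
  have hv := hb.v_pos
  have hvH : 0 < b.vHi := hv.trans_le hb.v_le
  have hx := infoGain_nonneg (M := M) h0 hl.le pos k
  have hcov := filterCov_apply_nonneg (M := M) h0 hl.le pos k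
  set S := filterCov M cov0 lamBar pos k with hS
  set y := infoCoeff M (pos k) with hy
  set G := ∑ l, y l * S l l with hG
  have hG0 : 0 ≤ G := Finset.sum_nonneg fun l _ => mul_nonneg (infoCoeff_nonneg _ l) (hcov l)
  have hY : M.infoMatrix (pos k) = Matrix.diagonal y := infoMatrix_eq_diagonal hb hM _
  have hys : b.vHi⁻¹ ≤ y s := inv_le_infoCoeff hM hb hs
  have hgain : infoGain M cov0 lamBar pos k = filterWeight M cov0 lamBar pos k * G := rfl
  set wn := weightedNorm S (M.infoMatrix (pos k)) with hwn
  have hwt : filterWeight M cov0 lamBar pos k = min 1 (lamBar / wn) := rfl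
  have hSp : S.PosSemidef := (filterCov_posDef hb hM h0 hl.le pos k).posSemidef
  rcases le_total 1 (lamBar / wn) with h1 | h1
  · rw [min_eq_left h1] at hwt
    rw [hwt, one_mul] at hgain
    have h2 : S s s ≤ b.vHi * G := by
      have h3 : y s * S s s ≤ G := Finset.single_le_sum (f := fun l => y l * S l l)
        (fun l _ => mul_nonneg (infoCoeff_nonneg _ l) (hcov l)) (Finset.mem_univ s)
      have h4 : b.vHi⁻¹ * S s s ≤ G := (mul_le_mul_of_nonneg_right hys (hcov s)).trans h3
      rwa [inv_mul_le_iff₀ hvH] at h4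
    have := Real.sqrt_le_sqrt h2
    rw [hgain] at hx ⊢
    have : 0 ≤ b.vHi * (I / b.vLo) / lamBar * G := by positivity
    linarith
  · rw [min_eq_right h1] at hwt
    have h2 : √(S s s) ≤ b.vHi * wn := by
      have h3 := sqrt_quadratic_mulVec_le_weightedNorm S (M.infoMatrix (pos k)) (Pi.single s 1)
      have h4 : l2norm (Pi.single s 1 : Fin N → ℝ) = 1 := by
        rw [l2norm_eq_sqrt]; simp
      have h5 : Matrix.diagonal y *ᵥ (Pi.single s 1 : Fin N → ℝ) = Pi.single s (y s) := by
        ext l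
        by_cases hls : l = s
        · subst hls; simp [Matrix.mulVec_diagonal]
        · simp [Matrix.mulVec_diagonal, hls]
      have hy0 : 0 ≤ y s := infoCoeff_nonneg _ s
      have h6 : (Pi.single s (y s) : Fin N → ℝ) ⬝ᵥ S *ᵥ Pi.single s (y s) = y s ^ 2 * S s s := by
        simp; ring
      rw [h4, mul_one, ← hwn, hY, h5, h6, Real.sqrt_mul (by positivity), Real.sqrt_sq hy0] at h3
      have h7 := (mul_le_mul_of_nonneg_right hys (Real.sqrt_nonneg (S s s))).trans h3
      rwa [inv_mul_le_iff₀ hvH] at h7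
    have h3 : wn ^ 2 ≤ I / b.vLo * G := by
      refine (weightedNorm_sq_le_trace hSp _).trans ?_
      rw [hY, Matrix.diagonal_transpose, Matrix.trace_mul_comm, ← Matrix.mul_assoc,
        Matrix.diagonal_mul_diagonal, trace_diagonal_mul, hG, Finset.mul_sum]
      refine Finset.sum_le_sum fun l _ => ?_
      have h4 := infoCoeff_le hb hM (pos k) l
      have h5 := mul_nonneg (infoCoeff_nonneg (M := M) (pos k) l) (hcov l)
      calc _ = y l * (y l * S l l) := by ring
        _ ≤ _ := mul_le_mul_of_nonneg_right h4 h5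
    have h4 : wn ≤ I / b.vLo / lamBar * infoGain M cov0 lamBar pos k := by
      rw [hgain, hwt]
      rcases (weightedNorm_nonneg S (M.infoMatrix (pos k))).eq_or_lt with hz | hz
      · rw [← hwn] at hz
        rw [← hz]; simp
      · have e : I / b.vLo / lamBar * (lamBar / wn * G) = I / b.vLo * G / wn := by
          have : wn ≠ 0 := hz.ne'
          field_simp
        rw [e, le_div_iff₀ hz, ← sq]
        exact h3
    have h5 := mul_le_mul_of_nonneg_left h4 hvH.le
    have h6 := Real.sqrt_nonneg (b.vHi * infoGain M cov0 lamBar pos k)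
    calc _ ≤ _ := h2
      _ ≤ _ := h5
      _ ≤ _ := by
        rw [mul_div_assoc b.vHi, mul_assoc]
        linarith

/-- The `L⁻¹`-norms decrease in time, so each new term may be measured by `L_k⁻¹` at its own time.
There its norm is `λ_k ‖Y_k d_k‖_{Σ_k}`, at most `λ̄ ‖d_k‖` by the choice of the weight. -/
theorem sqrt_disturbanceSum_le (h0 : cov0.PosDef)
    (hl : 0 ≤ lamBar) (pos : ℕ → Fin I → Fin N) (k : ℕ) :
    √(disturbanceSum M cov0 lamBar pos k ⬝ᵥ (precision M cov0 lamBar pos k)⁻¹ *ᵥ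
      disturbanceSum M cov0 lamBar pos k) ≤
        lamBar * ∑ t ∈ Finset.range k, l2norm (M.disturbedState t - M.state t) := by
  induction k with
  | zero => simp [disturbanceSum]
  | succ k ih =>
    rw [Finset.sum_range_succ, mul_add, disturbanceSum]
    refine ((precision_posDef h0 hl pos (k + 1)).inv.posSemidef.sqrt_add_le _ _).trans ?_
    have hmono := (precision_posDef (M := M) h0 hl pos k).inv_antitone
      (precision_mono hl pos k.le_succ)
    refine add_le_add ((Real.sqrt_le_sqrt (hmono _)).trans ih)
      ((Real.sqrt_le_sqrt (hmono _)).trans ?_)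
    set d := M.disturbedState k - M.state k
    have hw := filterWeight_nonneg (M := M) (cov0 := cov0) hl pos k
    have e : ∀ z : Fin N → ℝ, (filterWeight M cov0 lamBar pos k • z) ⬝ᵥ
        (precision M cov0 lamBar pos k)⁻¹ *ᵥ (filterWeight M cov0 lamBar pos k • z) =
        filterWeight M cov0 lamBar pos k ^ 2 * (z ⬝ᵥ (precision M cov0 lamBar pos k)⁻¹ *ᵥ z) := by
      intro z
      rw [Matrix.mulVec_smul, smul_dotProduct, dotProduct_smul]
      simp only [smul_eq_mul]; ring
    rw [e, ← filterCov_quadratic, Real.sqrt_mul (by positivity), Real.sqrt_sq hw]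
    have h1 := sqrt_quadratic_mulVec_le_weightedNorm
      (filterCov M cov0 lamBar pos k) (M.infoMatrix (pos k)) d
    have h2 : filterWeight M cov0 lamBar pos k *
        weightedNorm (filterCov M cov0 lamBar pos k) (M.infoMatrix (pos k)) ≤ lamBar :=
      adaptiveWeight_mul_weightedNorm_le hl _ _
    calc _ ≤ _ := mul_le_mul_of_nonneg_left h1 hw
      _ = (filterWeight M cov0 lamBar pos k *
        weightedNorm (filterCov M cov0 lamBar pos k) (M.infoMatrix (pos k))) * l2norm d := by ring
      _ ≤ _ := mul_le_mul_of_nonneg_right h2 (l2norm_nonneg d)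

theorem sum_disturbance_le (hM : M.Admissible b B) (k : ℕ) :
    ∑ t ∈ Finset.range k, l2norm (M.disturbedState t - M.state t) ≤ B k := by
  cases k with
  | zero => simpa using (hM.budget_pos 0).le
  | succ k =>
    rw [Finset.sum_range_succ']
    have h0 : l2norm (M.disturbedState 0 - M.state 0) = 0 := by
      simp [Model.disturbedState, Model.state, l2norm]
    -- The disturbance does not enter the dynamics, so the deviation at a time is a single term and
    -- does not accumulate.
    have h1 : ∀ t, M.disturbedState (t + 1) - M.state (t + 1) = M.dist t := fun t => by
      simp [Model.disturbedState, Model.state]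
    simp only [h0, h1, add_zero]
    refine le_trans ?_ (hM.budget (k + 1))
    exact Finset.sum_le_sum_of_subset_of_nonneg
      (Finset.range_subset_range.mpr (by lia)) fun t _ _ => l2norm_nonneg _

/-- Confidence bound for the filter, in terms of the self-normalized noise. -/
theorem abs_mean_sub_state_le (hM : M.Admissible b B) (hb : b.Valid)
    (hc : LoewnerBetween b.sigmaLo b.sigmaHi cov0) (hl : 0 ≤ lamBar) (mean0 : Fin N → ℝ)
    (pos : ℕ → Fin I → Fin N) (noise : ℕ → Fin I × Fin m → ℝ) (k : ℕ) (s : Fin N) :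
    |(kalmanFilter M mean0 cov0 lamBar (fun _ => 0) pos noise k).mean s - M.state k s| ≤
      √(filterCov M cov0 lamBar pos k s s) * (lamBar * B k +
        l2norm (mean0 - M.phi0) / √b.sigmaLo +
        √(noiseSum M cov0 lamBar pos noise k ⬝ᵥ (precision M cov0 lamBar pos k)⁻¹ *ᵥ
          noiseSum M cov0 lamBar pos noise k)) := by
  have h0 := posDef_of_loewner hb.sigma_pos hc
  have hp := precision_posDef (M := M) h0 hl pos k
  have hpath := (kalmanFilter_path hb hM h0 hl mean0 pos noise k).2
  set u0 := cov0⁻¹ *ᵥ (mean0 - M.phi0)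
  set D := disturbanceSum M cov0 lamBar pos k
  set S := noiseSum M cov0 lamBar pos noise k
  set L := precision M cov0 lamBar pos k
  have hs : (kalmanFilter M mean0 cov0 lamBar (fun _ => 0) pos noise k).mean s - M.state k s =
      ((propagation M.A 1 k)ᵀ *ᵥ Pi.single s 1) ⬝ᵥ L⁻¹ *ᵥ (u0 + D + S) := by
    have := congrFun hpath s
    rw [Pi.sub_apply] at this
    rw [this, Matrix.mulVec_transpose, ← Matrix.dotProduct_mulVec]
    simp
  have hcs := hp.inv.posSemidef.cauchy_schwarz ((propagation M.A 1 k)ᵀ *ᵥ Pi.single s 1)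
    (u0 + D + S)
  rw [← hs, ← filterCov_quadratic, ← apply_eq_quadratic_single] at hcs
  have h1 := Real.sqrt_le_sqrt hcs
  rw [Real.sqrt_sq_eq_abs, Real.sqrt_mul (filterCov_apply_nonneg h0 hl pos k s)] at h1
  refine h1.trans (mul_le_mul_of_nonneg_left ?_ (Real.sqrt_nonneg _))
  have h2 := hp.inv.posSemidef.sqrt_add_le (u0 + D) S
  have h3 := hp.inv.posSemidef.sqrt_add_le u0 D
  have h4 : √(D ⬝ᵥ L⁻¹ *ᵥ D) ≤ lamBar * B k := (sqrt_disturbanceSum_le h0 hl pos k).trans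
    (mul_le_mul_of_nonneg_left (sum_disturbance_le hM k) hl)
  have h5 : √(u0 ⬝ᵥ L⁻¹ *ᵥ u0) ≤ l2norm (mean0 - M.phi0) / √b.sigmaLo := by
    have h6 := (precision_posDef (M := M) h0 hl pos 0).inv_antitone
      (precision_mono hl pos (Nat.zero_le k)) u0
    have h7 : (precision M cov0 lamBar pos 0)⁻¹ *ᵥ u0 = mean0 - M.phi0 := by
      rw [precision, Matrix.nonsing_inv_nonsing_inv _ h0.isUnit_det_real, Matrix.mulVec_mulVec,
        Matrix.mul_nonsing_inv _ h0.isUnit_det_real, Matrix.one_mulVec]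
    rw [h7, dotProduct_comm u0 (mean0 - M.phi0)] at h6
    have h8 := quadratic_inv_le h0 hb.sigma_pos (fun x => (quadratic_bounds_of_loewner hc x).1)
      (mean0 - M.phi0)
    refine (Real.sqrt_le_sqrt (h6.trans h8)).trans_eq ?_
    rw [Real.sqrt_mul (inv_nonneg.mpr hb.sigma_pos.le), Real.sqrt_inv, ← l2norm_eq_sqrt]
    ring
  linarith

/-- Taking logarithms turns the complement of the Ville event into a bound on the self-normalized
noise. -/
theorem quadratic_le_of_mixture_lt {L L0 : Matrix (Fin N) (Fin N) ℝ} (hL : L.PosDef)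
    (hL0 : L0.PosDef) {S : Fin N → ℝ} {δ : ℝ} (hδ : 0 < δ)
    (h : mixture L S < mixture L0 0 / δ) :
    S ⬝ᵥ L⁻¹ *ᵥ S ≤ Real.log L.det - Real.log L0.det + 2 * Real.log (1 / δ) := by
  have hd := hL.det_pos
  have hd0 := hL0.det_pos
  have hpos : 0 < mixture L S := by unfold mixture; positivity
  have h1 := Real.log_lt_log hpos h
  have h2 : mixture L0 (0 : Fin N → ℝ) = (√L0.det)⁻¹ := by simp [mixture]
  rw [h2, mixture, Real.log_mul (by positivity) (by positivity), Real.log_exp, Real.log_inv,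
    Real.log_div (by positivity) hδ.ne', Real.log_inv, Real.log_sqrt hd.le,
    Real.log_sqrt hd0.le] at h1
  rw [one_div, Real.log_inv]
  linarith

end ModelFacts

/-! ### Regret of a single round. -/

section Regret

variable {I N : ℕ}

/-- Optimism: the best value of `f` is at most that of `mu`, which `p` attains, and at `p` the
excess of `mu` over `f` is at most twice the widths. -/
theorem regret_le_of_optimistic {f mu w : Fin N → ℝ} (h1 : ∀ s, f s ≤ mu s)
    (h2 : ∀ s, mu s ≤ f s + 2 * w s) {p : Fin I → Fin N}
    (hmax : ∀ q : Fin I → Fin N, objective mu q ≤ objective mu p) :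
    regret f p ≤ 2 * ∑ s ∈ Finset.univ.image p, w s := by
  have : Nonempty (Fin I → Fin N) := ⟨p⟩
  have hp : objective mu p ≤ objective f p + 2 * ∑ s ∈ Finset.univ.image p, w s := by
    rw [objective, objective, Finset.mul_sum, ← Finset.sum_add_distrib]
    exact Finset.sum_le_sum fun s _ => h2 s
  have : (⨆ q : Fin I → Fin N, objective f q) ≤ objective mu p :=
    ciSup_le fun q => (Finset.sum_le_sum fun s _ => h1 s).trans (hmax q)
  rw [regret]
  linarith

theorem sum_image_le {f : Fin N → ℝ} {c : ℝ} (hc : 0 ≤ c) (p : Fin I → Fin N)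
    (h : ∀ s ∈ Finset.univ.image p, f s ≤ c) : ∑ s ∈ Finset.univ.image p, f s ≤ I * c := by
  refine (Finset.sum_le_card_nsmul _ _ _ h).trans ?_
  rw [nsmul_eq_mul]
  have : (Finset.univ.image p).card ≤ I := Finset.card_image_le.trans_eq (by simp)
  gcongr

theorem regret_le_of_abs_le {f : Fin N → ℝ} {c : ℝ} (hc : 0 ≤ c) (h : ∀ s, |f s| ≤ c)
    (p : Fin I → Fin N) : regret f p ≤ 2 * (I * c) := by
  have : Nonempty (Fin I → Fin N) := ⟨p⟩
  have h1 : (⨆ q : Fin I → Fin N, objective f q) ≤ I * c :=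
    ciSup_le fun q => sum_image_le hc q fun s _ => (le_abs_self _).trans (h s)
  have h2 : -objective f p ≤ I * c := by
    rw [objective, ← Finset.sum_neg_distrib]
    exact sum_image_le hc p fun s _ => (neg_le_abs _).trans (h s)
  rw [regret]
  linarith

theorem regret_eq_zero [Subsingleton (Fin N)] (f : Fin N → ℝ) (p : Fin I → Fin N) :
    regret f p = 0 := by
  have : Unique (Fin I → Fin N) := ⟨⟨p⟩, fun q => Subsingleton.elim _ _⟩
  rw [regret, ciSup_unique, Subsingleton.elim (default : Fin I → Fin N) p, sub_self]

end Regret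

/-! ### Estimates for the confidence sequence. -/

section Constants

variable {b : Bounds}

theorem log_div_rpow {N : ℕ} {x δ : ℝ} (hx : 0 < x) (hδ : 0 < δ) :
    Real.log (x / δ ^ ((2 : ℝ) / N)) = Real.log x + 2 / N * Real.log (1 / δ) := by
  rw [Real.log_div hx.ne' (Real.rpow_pos_of_pos hδ _).ne', Real.log_rpow hδ, one_div, Real.log_inv]
  ring

theorem SourceSeeking.Bounds.Valid.one_le_ratio (hb : b.Valid) : 1 ≤ b.sigmaHi / b.sigmaLo :=
  (one_le_div hb.sigma_pos).mpr hb.sigma_le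

theorem SourceSeeking.Bounds.Valid.growth_pos (hb : b.Valid) : 0 < b.alphaHi * b.sigmaHi / b.vLo ^ 2 := by
  have := hb.alpha_pos.trans_le hb.alpha_le
  have := hb.sigma_pos.trans_le hb.sigma_le
  have := hb.v_pos
  positivity

theorem SourceSeeking.Bounds.Valid.log_inv_delta_nonneg (hb : b.Valid) : 0 ≤ Real.log (1 / b.delta) :=
  Real.log_nonneg ((one_le_div hb.delta_pos).mpr hb.delta_lt.le)

theorem one_le_C2 (b : Bounds) : 1 ≤ b.C2 := le_max_left _ _

theorem log_add_mul_le {c a : ℝ} (hc : 1 ≤ c) (ha : 0 ≤ a) {k K : ℕ} (hK : 0 < K) (hk : k ≤ K) :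
    Real.log (c + a * k) ≤ (1 + Real.log (c + a)) * (1 + Real.log K) := by
  have hK1 : (1 : ℝ) ≤ K := by exact_mod_cast hK
  have hkK : (k : ℝ) ≤ K := by exact_mod_cast hk
  have h1 : c + a * k ≤ (c + a) * K := by nlinarith
  have h2 := Real.log_le_log (by positivity) h1
  rw [Real.log_mul (by positivity) (by positivity)] at h2
  have h3 : 0 ≤ Real.log (c + a) := Real.log_nonneg (by linarith)
  have h4 : 0 ≤ Real.log K := Real.log_nonneg hK1
  nlinarith

/-- The confidence radius from self-normalization is below `betaBound` for large times. -/
theorem confidence_radius_le (hb : b.Valid) {c : ℝ} (hc : 0 ≤ c) {N : ℕ} (hN : 2 ≤ N) {k : ℕ}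
    (hk0 : (b.sigmaHi / b.sigmaLo + c) / (b.alphaHi * b.sigmaHi / b.vLo ^ 2) ^ 2 ≤ k)
    (hk1 : 1 ≤ k) {lamBar C1 Q : ℝ} {B : ℕ → ℝ} (hB : 0 ≤ lamBar * B k) (hC1 : 0 ≤ C1)
    (hQ : Q ≤ N * Real.log (b.sigmaHi / b.sigmaLo + c * k) + 2 * Real.log (1 / b.delta)) :
    lamBar * B k + C1 + √Q ≤ betaBound b N lamBar B C1 k := by
  have ha := hb.growth_pos
  have hr := hb.one_le_ratio
  have hd := hb.log_inv_delta_nonneg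
  have hC2 := one_le_C2 b
  have hN' : (2 : ℝ) ≤ N := by exact_mod_cast hN
  have hk1' : (1 : ℝ) ≤ k := by exact_mod_cast hk1
  rw [betaBound]
  have hx : b.sigmaHi / b.sigmaLo + b.alphaHi * b.sigmaHi * k / b.vLo ^ 2 =
      b.sigmaHi / b.sigmaLo + b.alphaHi * b.sigmaHi / b.vLo ^ 2 * k := by ring
  rw [hx]
  set a := b.alphaHi * b.sigmaHi / b.vLo ^ 2
  set r := b.sigmaHi / b.sigmaLo
  have hxpos : 1 ≤ r + a * k := by nlinarith
  rw [log_div_rpow (by linarith) hb.delta_pos]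
  set l := Real.log (r + a * k) + 2 / N * Real.log (1 / b.delta) with hl
  have hlx : 0 ≤ Real.log (r + a * k) := Real.log_nonneg hxpos
  -- The lower bound on `k` is chosen so that `r + c k ≤ (r + c) k ≤ (a k)² ≤ (r + a k)²`.
  have hcmp : Real.log (r + c * k) ≤ 2 * Real.log (r + a * k) := by
    rw [div_le_iff₀ (by positivity)] at hk0
    have h1 : r + c * k ≤ (r + a * k) ^ 2 := by
      have : r + c * k ≤ (r + c) * k := by nlinarith
      have : (r + c) * k ≤ k * a ^ 2 * k := mul_le_mul_of_nonneg_right hk0 (by linarith)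
      nlinarith [mul_nonneg (mul_nonneg (by linarith : (0 : ℝ) ≤ r) ha.le) (by linarith : (0 : ℝ) ≤ k)]
    have h2 := Real.log_le_log (by positivity) h1
    rwa [Real.log_pow] at h2
  -- Here `N ≥ 2` enters: the factor 2 lost in `hcmp` is absorbed by `2N ≤ N²`.
  have hQl : Q ≤ N ^ 2 * l := by
    have e : (N : ℝ) ^ 2 * l = N ^ 2 * Real.log (r + a * k) + 2 * N * Real.log (1 / b.delta) := by
      rw [hl]; field_simp
    rw [e]
    have h1 : N * Real.log (r + c * k) ≤ N * (2 * Real.log (r + a * k)) :=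
      mul_le_mul_of_nonneg_left hcmp (by linarith)
    nlinarith [mul_nonneg (by nlinarith : (0 : ℝ) ≤ N * (N - 2)) hlx]
  have hQs : √Q ≤ N * √l := by
    refine (Real.sqrt_le_sqrt hQl).trans_eq ?_
    rw [Real.sqrt_mul (by positivity), Real.sqrt_sq (by linarith)]
  have hsN : 1 ≤ √(N : ℝ) := Real.one_le_sqrt.mpr (by linarith)
  have hss : √(N : ℝ) * √N = N := Real.mul_self_sqrt (by linarith)
  have h3 : √(N : ℝ) * (lamBar * B k + C1 + b.C2 * √N * √l) =
      √N * (lamBar * B k + C1) + b.C2 * (N * √l) := by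
    linear_combination b.C2 * √l * hss
  rw [h3]
  have h4 : lamBar * B k + C1 ≤ √N * (lamBar * B k + C1) :=
    le_mul_of_one_le_left (by linarith) hsN
  have h5 : N * √l ≤ b.C2 * (N * √l) := le_mul_of_one_le_left (by positivity) hC2
  linarith

theorem betaBound_nonneg (b : Bounds) (N : ℕ) {lamBar C1 : ℝ} {B : ℕ → ℝ} {k : ℕ}
    (hB : 0 ≤ lamBar * B k) (hC1 : 0 ≤ C1) : 0 ≤ betaBound b N lamBar B C1 k := by
  have := one_le_C2 b
  unfold betaBound
  positivity

/-- All three terms inside the bracket of `betaBound` are of order `√N` up to logarithms once `λ̄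
B_k ≤ √N`; with the outer `√N` this gives order `N`. -/
theorem betaBound_le (hb : b.Valid) {N : ℕ} (hN : 1 ≤ N) {K k : ℕ} (hK : 0 < K) (hk : k ≤ K)
    {lamBar C1 r : ℝ} {B : ℕ → ℝ} (hB : lamBar * B k ≤ √N) (hC1 : 0 ≤ C1) (hr : C1 ≤ r) :
    betaBound b N lamBar B C1 k ≤ (1 + r + b.C2 * (1 + Real.log (b.sigmaHi / b.sigmaLo +
      b.alphaHi * b.sigmaHi / b.vLo ^ 2) + 2 * Real.log (1 / b.delta))) *
        (N * (1 + Real.log K)) := by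
  have ha := hb.growth_pos
  have hq := hb.one_le_ratio
  have hd := hb.log_inv_delta_nonneg
  have hC2 := one_le_C2 b
  have hN' : (1 : ℝ) ≤ N := by exact_mod_cast hN
  have hK1 : (1 : ℝ) ≤ K := by exact_mod_cast hK
  have hlK : 0 ≤ Real.log K := Real.log_nonneg hK1
  rw [betaBound]
  have hx : b.sigmaHi / b.sigmaLo + b.alphaHi * b.sigmaHi * k / b.vLo ^ 2 =
      b.sigmaHi / b.sigmaLo + b.alphaHi * b.sigmaHi / b.vLo ^ 2 * k := by ring
  rw [hx, log_div_rpow (by positivity) hb.delta_pos]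
  have hlog := log_add_mul_le hq ha.le hK hk
  set a := b.alphaHi * b.sigmaHi / b.vLo ^ 2
  set q := b.sigmaHi / b.sigmaLo
  have hlqa : 0 ≤ Real.log (q + a) := Real.log_nonneg (by linarith)
  set c := 1 + Real.log (q + a) + 2 * Real.log (1 / b.delta) with hc
  have hc1 : 1 ≤ c := by linarith
  set ℓ := 1 + Real.log (K : ℝ) with hℓ
  have hℓ1 : 1 ≤ ℓ := by linarith
  have h2N : 2 / (N : ℝ) ≤ 2 := by rw [div_le_iff₀ (by linarith)]; linarith
  have hle : Real.log (q + a * k) + 2 / N * Real.log (1 / b.delta) ≤ c * ℓ := by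
    have := mul_le_mul_of_nonneg_right h2N hd
    nlinarith
  have hsq : √(Real.log (q + a * k) + 2 / N * Real.log (1 / b.delta)) ≤ c * ℓ := by
    refine (Real.sqrt_le_sqrt hle).trans ?_
    rw [Real.sqrt_le_iff]
    have : 1 ≤ c * ℓ := by nlinarith
    constructor <;> nlinarith
  set z := √(Real.log (q + a * k) + 2 / N * Real.log (1 / b.delta))
  have hz : 0 ≤ z := Real.sqrt_nonneg _
  have hsN : 1 ≤ √(N : ℝ) := Real.one_le_sqrt.mpr (by linarith)
  have hss : √(N : ℝ) * √N = N := Real.mul_self_sqrt (by linarith)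
  have h1 : √(N : ℝ) * (lamBar * B k + C1 + b.C2 * √N * z) ≤ √N * (√N + r * √N + b.C2 * √N * z) := by
    have : C1 ≤ r * √N := by nlinarith
    gcongr
  have h2 : √(N : ℝ) * (√N + r * √N + b.C2 * √N * z) = N * (1 + r + b.C2 * z) := by
    linear_combination (1 + r + b.C2 * z) * hss
  have h3 : 1 + r + b.C2 * z ≤ (1 + r + b.C2 * c) * ℓ := by
    have : b.C2 * z ≤ b.C2 * (c * ℓ) := by gcongr
    nlinarith
  calc _ ≤ _ := h1
    _ = _ := h2
    _ ≤ N * ((1 + r + b.C2 * c) * ℓ) := by gcongr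
    _ = _ := by ring

end Constants

/-! ### Summation over the rounds and the theorem. -/

section Assembly

variable {I N m : ℕ} {M : Model I N m} {b : Bounds} {B : ℕ → ℝ}
  {cov0 : Matrix (Fin N) (Fin N) ℝ} {lamBar : ℝ}

/-- One factor `N` comes from the dimension in `log det`, the other from the size of a single gain.
-/
theorem sum_infoGain_le (hM : M.Admissible b B) (hb : b.Valid) (hN : 1 ≤ N)
    (hc : LoewnerBetween b.sigmaLo b.sigmaHi cov0) (hl : 0 ≤ lamBar) (pos : ℕ → Fin I → Fin N)
    {K : ℕ} (hK : 0 < K) : ∑ k ∈ Finset.range (K + 1), infoGain M cov0 lamBar pos k ≤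
      ((1 + I / b.vLo * (b.sigmaHi * max 1 b.alphaHi)) * (1 + Real.log (b.sigmaHi / b.sigmaLo +
        2 * (b.sigmaHi * (max 1 b.alphaHi * (I / b.vLo)))))) * ((N : ℝ) ^ 2 * (1 + Real.log K)) := by
  have hv := hb.v_pos
  have hs := hb.sigma_pos.trans_le hb.sigma_le
  have hN' : (1 : ℝ) ≤ N := by exact_mod_cast hN
  have hK1 : (1 : ℝ) ≤ K := by exact_mod_cast hK
  have h1 := sum_infoGain_le_log_det hM hb hc hl pos (K + 1)
  have h2 := log_det_precision_le hM hb hc hl pos (K + 1)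
  have hq := hb.one_le_ratio
  have hc0 : 0 ≤ b.sigmaHi * (max 1 b.alphaHi * (I / b.vLo)) := by positivity
  have hX0 : 0 ≤ I / b.vLo * (b.sigmaHi * max 1 b.alphaHi) := by positivity
  set c := b.sigmaHi * (max 1 b.alphaHi * (I / b.vLo))
  set q := b.sigmaHi / b.sigmaLo
  set X := I / b.vLo * (b.sigmaHi * max 1 b.alphaHi)
  have h3 : Real.log (q + c * (K + 1 : ℕ)) ≤ Real.log (q + 2 * c * K) := by
    refine Real.log_le_log (by positivity) ?_
    push_cast
    nlinarith
  have h4 := log_add_mul_le (a := 2 * c) hq (by positivity) hK le_rfl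
  have h5 : N * Real.log (q + c * (K + 1 : ℕ)) ≤
      N * ((1 + Real.log (q + 2 * c)) * (1 + Real.log K)) :=
    mul_le_mul_of_nonneg_left (h3.trans h4) (by positivity)
  have hlog0 : 0 ≤ Real.log (q + 2 * c) := Real.log_nonneg (by linarith)
  have hlogK : 0 ≤ Real.log K := Real.log_nonneg hK1
  calc _ ≤ _ := h1
    _ ≤ (1 + N * X) * (N * ((1 + Real.log (q + 2 * c)) * (1 + Real.log K))) :=
        mul_le_mul_of_nonneg_left (h2.trans h5) (by positivity)
    _ ≤ (N * (1 + X)) * (N * ((1 + Real.log (q + 2 * c)) * (1 + Real.log K))) :=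
        mul_le_mul_of_nonneg_right (by linarith) (by positivity)
    _ = _ := by ring

theorem sum_sqrt_le (n : ℕ) {f : ℕ → ℝ} (hf : ∀ k, 0 ≤ f k) :
    ∑ k ∈ Finset.range n, √(f k) ≤ √(n * ∑ k ∈ Finset.range n, f k) := by
  refine Real.le_sqrt_of_sq_le ?_
  have h := sq_sum_le_card_mul_sum_sq (s := Finset.range n) (f := fun k => √(f k))
  simpa [Real.sq_sqrt (hf _)] using h

theorem rpow_five_halves (N : ℕ) (hN : 1 ≤ N) :
    (N : ℝ) ^ ((5 : ℝ) / 2) = (N : ℝ) ^ 3 / √N := by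
  have hN' : (0 : ℝ) < N := by exact_mod_cast hN
  rw [Real.sqrt_eq_rpow, ← Real.rpow_natCast, ← Real.rpow_sub hN']
  norm_num

/-- Regret of a round in which the filter is confident and the positions maximize the D-UCB. -/
theorem regret_le_of_confident (hM : M.Admissible b B) (hb : b.Valid)
    (hc : LoewnerBetween b.sigmaLo b.sigmaHi cov0) (hl : 0 < lamBar) {mean0 : Fin N → ℝ}
    {pos : ℕ → Fin I → Fin N} {noise : ℕ → Fin I × Fin m → ℝ} {k : ℕ} {β : ℝ}
    (hβ : lamBar * B k + l2norm (mean0 - M.phi0) / √b.sigmaLo +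
      √(noiseSum M cov0 lamBar pos noise k ⬝ᵥ (precision M cov0 lamBar pos k)⁻¹ *ᵥ
        noiseSum M cov0 lamBar pos noise k) ≤ β)
    (hmax : ∀ q : Fin I → Fin N,
      objective (ducb (kalmanFilter M mean0 cov0 lamBar (fun _ => 0) pos noise k) β) q ≤
        objective (ducb (kalmanFilter M mean0 cov0 lamBar (fun _ => 0) pos noise k) β) (pos k)) :
    regret (M.state k) (pos k) ≤ 2 * (β * (I * (√b.vHi * √(infoGain M cov0 lamBar pos k) +
      b.vHi * (I / b.vLo) / lamBar * infoGain M cov0 lamBar pos k))) := by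
  have h0 := posDef_of_loewner hb.sigma_pos hc
  have hx := infoGain_nonneg (M := M) h0 hl.le pos k
  have hv := hb.v_pos
  have hvH : 0 < b.vHi := hv.trans_le hb.v_le
  have hβ0 : 0 ≤ β := by
    have := mul_nonneg hl.le (hM.budget_pos k).le
    have := l2norm_nonneg (mean0 - M.phi0)
    refine le_trans ?_ hβ
    positivity
  have hcov := (kalmanFilter_path hb hM h0 hl.le mean0 pos noise k).1
  set x := kalmanFilter M mean0 cov0 lamBar (fun _ => 0) pos noise k
  have herr : ∀ s, |x.mean s - M.state k s| ≤ β * √(filterCov M cov0 lamBar pos k s s) := by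
    intro s
    refine (abs_mean_sub_state_le hM hb hc hl.le mean0 pos noise k s).trans ?_
    rw [mul_comm]
    exact mul_le_mul_of_nonneg_right hβ (Real.sqrt_nonneg _)
  have hreg := regret_le_of_optimistic (f := M.state k) (mu := ducb x β)
    (w := fun s => β * √(filterCov M cov0 lamBar pos k s s)) (fun s => ?_) (fun s => ?_) hmax
  · refine hreg.trans ?_
    rw [← Finset.mul_sum]
    gcongr
    refine sum_image_le (by positivity) _ fun s hs => ?_
    rw [← Real.sqrt_mul hvH.le]
    exact sqrt_filterCov_le hM hb h0 hl pos k hs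
  · have := (abs_le.mp (herr s)).1
    simp only [ducb, hcov]
    linarith
  · have := (abs_le.mp (herr s)).2
    simp only [ducb, hcov]
    linarith

-- The deterministic half of the theorem, on a path where the mixture stays below its threshold.
-- Absolute values of `κ` and `ρ` keep the constant nonnegative, as it is chosen before anything
-- forces their signs.
set_option maxHeartbeats 1000000 in
theorem exists_const_cumRegret_le (I : ℕ) (b : Bounds) (κ ρ : ℝ) (hb : b.Valid) :
    ∃ C : ℝ, 0 ≤ C ∧ ∀ (N m : ℕ) (M : Model I N m) (B : ℕ → ℝ) (mean0 : Fin N → ℝ)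
      (cov0 : Matrix (Fin N) (Fin N) ℝ), 2 ≤ N → M.Admissible b B →
      LoewnerBetween b.sigmaLo b.sigmaHi cov0 → l2norm M.phi0 ≤ ρ → l2norm (mean0 - M.phi0) ≤ ρ →
      ∀ (K : ℕ), 0 < K → ∀ (lamBar : ℝ), lamBar = √N / B K → ∀ (beta : ℕ → ℝ),
        (∀ k, betaBound b N lamBar B (l2norm (mean0 - M.phi0) / √b.sigmaLo) k ≤ beta k ∧
          beta k ≤ κ * betaBound b N lamBar B (l2norm (mean0 - M.phi0) / √b.sigmaLo) k) →
        ∀ (pos : ℕ → Fin I → Fin N) (noise : ℕ → Fin I × Fin m → ℝ),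
          (∀ k, ∀ q : Fin I → Fin N, objective (ducb (kalmanFilter M mean0 cov0 lamBar
              (fun _ => 0) pos noise (k + 1)) (beta (k + 1))) q ≤
            objective (ducb (kalmanFilter M mean0 cov0 lamBar
              (fun _ => 0) pos noise (k + 1)) (beta (k + 1))) (pos (k + 1))) →
          (∀ k ≤ K, mixture (precision M cov0 lamBar pos k) (noiseSum M cov0 lamBar pos noise k) <
            mixture cov0⁻¹ 0 / b.delta) →
          cumRegret M pos K ≤ C * ((N : ℝ) ^ 2 * √K + (N : ℝ) ^ ((5 : ℝ) / 2) * B K) *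
            (1 + Real.log K) ^ 2 := by
  have hv := hb.v_pos
  have hvH : 0 < b.vHi := hv.trans_le hb.v_le
  have hs := hb.sigma_pos.trans_le hb.sigma_le
  have hq := hb.one_le_ratio
  have ha := hb.growth_pos
  have hld := hb.log_inv_delta_nonneg
  have hC2 := one_le_C2 b
  obtain ⟨c, hcdef⟩ : ∃ c, c = b.sigmaHi * (max 1 b.alphaHi * (I / b.vLo)) := ⟨_, rfl⟩
  obtain ⟨c5, hc5⟩ : ∃ c5, c5 = 1 + |ρ| / √b.sigmaLo + b.C2 * (1 + Real.log (b.sigmaHi / b.sigmaLo +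
      b.alphaHi * b.sigmaHi / b.vLo ^ 2) + 2 * Real.log (1 / b.delta)) := ⟨_, rfl⟩
  obtain ⟨c8, hc8⟩ : ∃ c8, c8 = (1 + I / b.vLo * (b.sigmaHi * max 1 b.alphaHi)) *
      (1 + Real.log (b.sigmaHi / b.sigmaLo +
        2 * (b.sigmaHi * (max 1 b.alphaHi * (I / b.vLo))))) := ⟨_, rfl⟩
  obtain ⟨c9, hc9⟩ : ∃ c9, c9 = 2 * (I * (√(max 1 b.alphaHi) * |ρ|)) := ⟨_, rfl⟩
  -- Before time `k0` the prescribed `β_k` may be too small for a confidence bound; `k0` depends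
  -- only on `I` and `b`.
  obtain ⟨k0, hk0⟩ := exists_nat_ge ((b.sigmaHi / b.sigmaLo + c) /
    (b.alphaHi * b.sigmaHi / b.vLo ^ 2) ^ 2)
  have hcnn : 0 ≤ c := by rw [hcdef]; positivity
  have hc5nn : 0 ≤ c5 := by
    have : 0 ≤ Real.log (b.sigmaHi / b.sigmaLo + b.alphaHi * b.sigmaHi / b.vLo ^ 2) :=
      Real.log_nonneg (by linarith)
    rw [hc5]; positivity
  have hc8nn : 0 ≤ c8 := by
    have : 0 ≤ Real.log (b.sigmaHi / b.sigmaLo +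
        2 * (b.sigmaHi * (max 1 b.alphaHi * (I / b.vLo)))) :=
      Real.log_nonneg (by rw [← hcdef]; linarith)
    rw [hc8]; positivity
  have hc9nn : 0 ≤ c9 := by rw [hc9]; positivity
  refine ⟨(k0 + 1 : ℕ) * c9 + 2 * (|κ| * c5 * I) * (√b.vHi * √(2 * c8) + b.vHi * (I / b.vLo) * c8),
    by positivity, ?_⟩
  intro N m M B mean0 cov0 hN hM hcov hphi hmean K hK lamBar hlam beta hbeta pos noise hmax hgood
  have hN0 : (0 : ℝ) < N := by exact_mod_cast (by lia : 0 < N)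
  have hN1 : (1 : ℝ) ≤ N := by exact_mod_cast (by lia : 1 ≤ N)
  have hK1 : (1 : ℝ) ≤ K := by exact_mod_cast hK
  have hBK := hM.budget_pos K
  have hl : 0 < lamBar := by rw [hlam]; positivity
  have h0 := posDef_of_loewner hb.sigma_pos hcov
  set ℓ := 1 + Real.log (K : ℝ) with hℓ
  have hℓ1 : 1 ≤ ℓ := by linarith [Real.log_nonneg hK1]
  have hC1 : 0 ≤ l2norm (mean0 - M.phi0) / √b.sigmaLo :=
    div_nonneg (l2norm_nonneg _) (Real.sqrt_nonneg _)
  have hlB : ∀ k, 0 ≤ lamBar * B k := fun k => mul_nonneg hl.le (hM.budget_pos k).le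
  have hlB' : ∀ k ≤ K, lamBar * B k ≤ √N := by
    intro k hk
    rw [hlam, div_mul_eq_mul_div, div_le_iff₀ hBK]
    exact mul_le_mul_of_nonneg_left (hM.budget_mono hk) (Real.sqrt_nonneg _)
  have hbetaUp : ∀ k ≤ K, beta k ≤ |κ| * c5 * (N * ℓ) := by
    intro k hk
    have h1 : betaBound b N lamBar B (l2norm (mean0 - M.phi0) / √b.sigmaLo) k ≤ c5 * (N * ℓ) := by
      rw [hc5]
      refine betaBound_le hb (by lia) hK hk (hlB' k hk) hC1 ?_
      gcongr
      exact hmean.trans (le_abs_self ρ)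
    have h2 := betaBound_nonneg b N (hlB k) hC1
    calc beta k ≤ κ * _ := (hbeta k).2
      _ ≤ |κ| * _ := mul_le_mul_of_nonneg_right (le_abs_self κ) h2
      _ ≤ |κ| * (c5 * (N * ℓ)) := mul_le_mul_of_nonneg_left h1 (abs_nonneg κ)
      _ = _ := by ring
  set x := infoGain M cov0 lamBar pos with hx
  have hxnn : ∀ k, 0 ≤ x k := infoGain_nonneg h0 hl.le pos
  -- Rounds up to `k0`, including round 0 with its arbitrary positions, cost at most `c9`, which is
  -- free of `N`; later ones are optimistic.
  have hround : ∀ k ∈ Finset.range (K + 1), regret (M.state k) (pos k) ≤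
      (if k ∈ Finset.range (k0 + 1) then c9 else 0) +
        2 * (|κ| * c5 * (N * ℓ) * (I * (√b.vHi * √(x k) +
          b.vHi * (I / b.vLo) / lamBar * x k))) := by
    intro k hkK
    have hkK' : k ≤ K := by simpa [Nat.lt_succ_iff] using hkK
    have hxk := hxnn k
    by_cases hk : k ∈ Finset.range (k0 + 1)
    · rw [if_pos hk]
      have hr := regret_le_of_abs_le (c := √(max 1 b.alphaHi) * |ρ|) (by positivity)
        (abs_state_le hM (hphi.trans (le_abs_self ρ)) k) (pos k)
      rw [← hc9] at hr
      have : 0 ≤ 2 * (|κ| * c5 * (N * ℓ) * (I * (√b.vHi * √(x k) +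
          b.vHi * (I / b.vLo) / lamBar * x k))) := by positivity
      linarith
    · rw [if_neg hk, zero_add]
      have hk' : k0 + 1 ≤ k := by simpa using hk
      obtain ⟨j, rfl⟩ : ∃ j, k = j + 1 := ⟨k - 1, by lia⟩
      have hQ := quadratic_le_of_mixture_lt (precision_posDef h0 hl.le pos (j + 1)) h0.inv
        hb.delta_pos (hgood (j + 1) hkK')
      have hdet := log_det_precision_le hM hb hcov hl.le pos (j + 1)
      rw [← hcdef] at hdet
      have hkk : (k0 : ℝ) ≤ (j + 1 : ℕ) := by exact_mod_cast (by lia)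
      have hrad := confidence_radius_le hb hcnn hN (hk0.trans hkk) (by lia) (hlB (j + 1)) hC1
        (hQ.trans (by linarith))
      have hreg := regret_le_of_confident hM hb hcov hl (hrad.trans (hbeta (j + 1)).1) (hmax j)
      refine hreg.trans ?_
      have := hbetaUp (j + 1) hkK'
      gcongr
  have hS := sum_infoGain_le hM hb (by lia) hcov hl.le pos hK
  rw [← hc8, ← hℓ] at hS
  have hsqrt : ∑ k ∈ Finset.range (K + 1), √(x k) ≤ √(2 * c8) * (N * √K * ℓ) := by
    refine (sum_sqrt_le _ hxnn).trans ?_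
    have h1 : ((K + 1 : ℕ) : ℝ) * ∑ k ∈ Finset.range (K + 1), x k ≤
        2 * c8 * (N * √K * ℓ) ^ 2 := by
      have h2 : ((K + 1 : ℕ) : ℝ) ≤ 2 * K := by push_cast; linarith
      calc _ ≤ 2 * K * (c8 * ((N : ℝ) ^ 2 * ℓ)) :=
            mul_le_mul h2 hS (Finset.sum_nonneg fun k _ => hxnn k) (by positivity)
        -- One logarithm is given away to make a perfect square under the root.
        _ ≤ 2 * K * (c8 * ((N : ℝ) ^ 2 * (ℓ * ℓ))) := by
            gcongr
            exact le_mul_of_one_le_left (by linarith) hℓ1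
        _ = _ := by
            have : √(K : ℝ) ^ 2 = K := Real.sq_sqrt (by linarith)
            rw [mul_pow, mul_pow, this]; ring
    refine (Real.sqrt_le_sqrt h1).trans_eq ?_
    rw [Real.sqrt_mul (by positivity), Real.sqrt_sq (by positivity)]
  have hfirst : ∑ k ∈ Finset.range (K + 1), (if k ∈ Finset.range (k0 + 1) then c9 else 0) ≤
      (k0 + 1 : ℕ) * c9 := by
    rw [← Finset.sum_filter, Finset.sum_const, nsmul_eq_mul]
    have : ((Finset.range (K + 1)).filter (· ∈ Finset.range (k0 + 1))).card ≤ k0 + 1 := by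
      refine (Finset.card_le_card (t := Finset.range (k0 + 1)) fun k hk => ?_).trans_eq (by simp)
      exact (Finset.mem_filter.mp hk).2
    gcongr
  -- `N³` combines `N` from `β_k` with `N²` from the total gain.
  have hinv : 1 / lamBar * N ^ 3 = (N : ℝ) ^ ((5 : ℝ) / 2) * B K := by
    rw [rpow_five_halves N (by lia), hlam]
    have : √(N : ℝ) ≠ 0 := (Real.sqrt_pos.mpr hN0).ne'
    field_simp
  set U := (N : ℝ) ^ 2 * √K with hU
  set V := (N : ℝ) ^ ((5 : ℝ) / 2) * B K with hV
  have hU1 : 1 ≤ U := by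
    exact one_le_mul_of_one_le_of_one_le (one_le_pow₀ hN1) (Real.one_le_sqrt.mpr hK1)
  have hV0 : 0 ≤ V := by positivity
  have hmain : N * ℓ * (√b.vHi * ∑ k ∈ Finset.range (K + 1), √(x k) +
      b.vHi * (I / b.vLo) / lamBar * ∑ k ∈ Finset.range (K + 1), x k) ≤
      (√b.vHi * √(2 * c8) + b.vHi * (I / b.vLo) * c8) * (U + V) * ℓ ^ 2 := by
    calc _ ≤ N * ℓ * (√b.vHi * (√(2 * c8) * (N * √K * ℓ)) +
          b.vHi * (I / b.vLo) / lamBar * (c8 * ((N : ℝ) ^ 2 * ℓ))) := by gcongr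
      _ = (√b.vHi * √(2 * c8) * U + b.vHi * (I / b.vLo) * c8 * V) * ℓ ^ 2 := by
          rw [← hinv, hU]; ring
      _ ≤ _ := by
          have e1 : 0 ≤ √b.vHi * √(2 * c8) * V := by positivity
          have e2 : 0 ≤ b.vHi * (I / b.vLo) * c8 * U := by positivity
          refine mul_le_mul_of_nonneg_right ?_ (by positivity)
          linarith
  rw [cumRegret]
  refine (Finset.sum_le_sum hround).trans ?_
  rw [Finset.sum_add_distrib]
  have hsecond : ∑ k ∈ Finset.range (K + 1), 2 * (|κ| * c5 * (N * ℓ) * (I * (√b.vHi * √(x k) +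
      b.vHi * (I / b.vLo) / lamBar * x k))) = 2 * (|κ| * c5 * I) * (N * ℓ *
        (√b.vHi * ∑ k ∈ Finset.range (K + 1), √(x k) +
          b.vHi * (I / b.vLo) / lamBar * ∑ k ∈ Finset.range (K + 1), x k)) := by
    rw [Finset.mul_sum, Finset.mul_sum, ← Finset.sum_add_distrib, Finset.mul_sum, Finset.mul_sum]
    exact Finset.sum_congr rfl fun k _ => by ring
  rw [hsecond]
  have hthird : ((k0 + 1 : ℕ) : ℝ) * c9 ≤ (k0 + 1 : ℕ) * c9 * (U + V) * ℓ ^ 2 := by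
    rw [mul_assoc]
    refine le_mul_of_one_le_right (by positivity) ?_
    exact one_le_mul_of_one_le_of_one_le (by linarith) (one_le_pow₀ hℓ1)
  have hfourth := mul_le_mul_of_nonneg_left hmain
    (by positivity : 0 ≤ 2 * (|κ| * c5 * I))
  calc _ ≤ (k0 + 1 : ℕ) * c9 * (U + V) * ℓ ^ 2 + 2 * (|κ| * c5 * I) *
        ((√b.vHi * √(2 * c8) + b.vHi * (I / b.vLo) * c8) * (U + V) * ℓ ^ 2) :=
      add_le_add (hfirst.trans hthird) hfourth
    _ = _ := by ring

end Assembly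

theorem theorem1 :
    ∃ q : ℕ, ∀ (I : ℕ) (b : Bounds) (κ ρ : ℝ), b.Valid →
      ∃ C : ℝ, ∀ (N m : ℕ) (M : Model I N m) (B : ℕ → ℝ) (mean0 : Fin N → ℝ)
        (cov0 : Matrix (Fin N) (Fin N) ℝ),
        M.Admissible b B →
        LoewnerBetween b.sigmaLo b.sigmaHi cov0 →
        l2norm M.phi0 ≤ ρ →
        l2norm (mean0 - M.phi0) ≤ ρ →
        ∀ (Ω : Type*) [MeasurableSpace Ω] (P : Measure Ω) [IsProbabilityMeasure P]
          (ℱ : Filtration ℕ ‹MeasurableSpace Ω›) (noise : ℕ → Ω → Fin I × Fin m → ℝ),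
          IsNoise M P ℱ noise →
          ∀ (K : ℕ), 0 < K → ∀ (lamBar : ℝ), lamBar = Real.sqrt N / B K →
          ∀ (beta : ℕ → ℝ),
            (∀ k, betaBound b N lamBar B (l2norm (mean0 - M.phi0) / Real.sqrt b.sigmaLo) k
                ≤ beta k ∧
              beta k ≤
                κ * betaBound b N lamBar B (l2norm (mean0 - M.phi0) / Real.sqrt b.sigmaLo) k) →
          ∀ (pos : ℕ → Ω → Fin I → Fin N),
            IsRun M ℱ noise mean0 cov0 lamBar (fun _ => 0) beta pos →
            ENNReal.ofReal (1 - b.delta) ≤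
              P {w | cumRegret M (fun k => pos k w) K ≤
                C * ((N : ℝ) ^ 2 * Real.sqrt K + (N : ℝ) ^ ((5 : ℝ) / 2) * B K) *
                  (1 + Real.log K) ^ q} := by
  refine ⟨2, fun I b κ ρ hb => ?_⟩
  obtain ⟨C, hC0, hC⟩ := exists_const_cumRegret_le I b κ ρ hb
  refine ⟨C, ?_⟩
  intro N m M B mean0 cov0 hM hcov hphi hmean Ω _ P _ ℱ noise hn K hK lamBar hlam beta hbeta pos hrun
  have hK1 : (1 : ℝ) ≤ K := by exact_mod_cast hK
  have hBK := hM.budget_pos K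
  have hlog := Real.log_nonneg hK1
  -- With at most one position there is no choice to regret; this case lies outside
  -- `confidence_radius_le`.
  rcases Nat.lt_or_ge N 2 with hN | hN
  · have : Subsingleton (Fin N) := by
      rcases (by lia : N = 0 ∨ N = 1) with rfl | rfl <;> infer_instance
    have huniv : {w | cumRegret M (fun k => pos k w) K ≤
        C * ((N : ℝ) ^ 2 * Real.sqrt K + (N : ℝ) ^ ((5 : ℝ) / 2) * B K) *
          (1 + Real.log K) ^ 2} = Set.univ := by
      refine Set.eq_univ_of_forall fun w => ?_
      have h0 : cumRegret M (fun k => pos k w) K = 0 :=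
        Finset.sum_eq_zero fun k _ => regret_eq_zero _ _
      change cumRegret M (fun k => pos k w) K ≤ _
      rw [h0]
      positivity
    rw [huniv, measure_univ]
    exact ENNReal.ofReal_le_one.mpr (by linarith [hb.delta_pos])
  · have hl : 0 ≤ lamBar := by rw [hlam]; positivity
    set bad := {w | ∃ k ≤ K, mixture cov0⁻¹ 0 / b.delta ≤
      mixture (precision M cov0 lamBar (fun t => pos t w) k)
        (noiseSum M cov0 lamBar (fun t => pos t w) (fun t => noise t w) k)} with hbad
    have hbadP : P bad ≤ ENNReal.ofReal b.delta :=
      measure_selfNormalized_le hrun.adapted hn (noise_var_pos hb hM)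
        (posDef_of_loewner hb.sigma_pos hcov) hl hb.delta_pos K
    have hgood : badᶜ ⊆ {w | cumRegret M (fun k => pos k w) K ≤
        C * ((N : ℝ) ^ 2 * Real.sqrt K + (N : ℝ) ^ ((5 : ℝ) / 2) * B K) *
          (1 + Real.log K) ^ 2} := by
      intro w hw
      refine hC N m M B mean0 cov0 hN hM hcov hphi hmean K hK lamBar hlam beta hbeta
        (fun t => pos t w) (fun t => noise t w) (fun k => hrun.maximizes k w) fun k hk => ?_
      by_contra! hlt
      exact hw ⟨k, hk, hlt⟩
    refine le_trans ?_ (measure_mono hgood)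
    -- Subadditivity suffices here, so no measurability of the regret event is required.
    have hone : 1 ≤ P bad + P badᶜ := by
      rw [← measure_univ (μ := P), ← Set.union_compl_self bad]
      exact measure_union_le _ _
    rw [ENNReal.ofReal_sub _ hb.delta_pos.le, ENNReal.ofReal_one, tsub_le_iff_left]
    exact hone.trans (add_le_add hbadP le_rfl)
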